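/- Let $N\in\mathbb{N}$ and let $\Phi:[0,\infty)\to[0,\infty)$ be a Young function, i.e. $\Phi$ is convex, $\Phi(t)=0$ if and only if $t=0$, $\lim_{t\to0^+}\Phi(t)/t=0$ and $\lim_{t\to+\infty}\Phi(t)/t=+\infty$. Suppose that $\Phi$ is of class $C^2$ in $(0,\infty)$ and that, with $\phi:=\Phi'$, $$0<\inf_{t>0}\frac{t\phi'(t)}{\phi(t)}\le\sup_{t>0}\frac{t\phi'(t)}{\phi(t)}<+\infty,\qquad s_\Phi:=\sup_{t>0}\frac{t\Phi'(t)}{\Phi(t)}<N$$ (so that $N\ge2$). Write $\phi^{-1}$ for the inverse of the bijection $\phi:(0,\infty)\to(0,\infty)$, $B_r$ for the open ball of radius $r$ centred at $0$, and $B_r^e:=\mathbb{R}^N\setminus\overline{B}_r$. Let $\Phi_*:=\Phi\circ\mathscr{H}^{-1}$, where $\mathscr{H}(t):=\left(\int_0^t(\tau/\Phi(\tau))^{\frac1{N-1}}\,d\tau\right)^{\frac{N-1}{N}}$, be the Sobolev conjugate of $\Phi$, and let $\mathcal{D}^{1,\Phi}_0(B_r^e)$ be the set of all $u\in L^{\Phi_*}(B_r^e)$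 having a weak gradient with $|\nabla u|\in L^\Phi(B_r^e)$ for which there are $u_n\in C^\infty_c(\mathbb{R}^N)$ with $\|\nabla u_n-\nabla u\|_{L^\Phi(B_r^e)}\to0$ (Luxemburg norm); no condition is imposed on $\partial B_r$. Then for all $c,r>0$ there is a unique $k>0$ such that $\int_r^{+\infty}\phi^{-1}(ks^{1-N})\,ds=c$. With this $k$, the function $$\underline{w}(x):=\int_{|x|}^{+\infty}\phi^{-1}(ks^{1-N})\,ds,\qquad x\in\mathbb{R}^N\setminus\{0\},$$ is well defined (the integral converges), belongs to $C^1(\mathbb{R}^N\setminus\{0\})$, satisfies $\underline{w}|_{B_r^e}\in\mathcal{D}^{1,\Phi}_0(B_r^e)$, and solves $$\begin{cases}\mathrm{div}\left(\phi(|\nabla\underline{w}|)\dfrac{\nabla\underline{w}}{|\nabla\underline{w}|}\right)=0&\text{in }\mathbb{R}^N\setminus\{0\}\text{ in the sense of distributions},\\ \underline{w}=c&\text{on }\partial B_r,\\ \underline{w}(x)\to0&\text{as }|x|\to+\infty.\end{cases}$$ -/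

import Mathlib

open MeasureTheory Filter Topology Set
open scoped ENNReal ContDiff Gradient RealInnerProductSpace

noncomputable section

/-- Young functions `Λ : [0,∞) → [0,∞)`; the values of `Λ` at negative numbers are irrelevant. -/
structure IsYoungFunction (Λ : ℝ → ℝ) : Prop where
  convexOn : ConvexOn ℝ (Ici 0) Λ
  nonneg : ∀ t, 0 ≤ t → 0 ≤ Λ t
  eq_zero_iff : ∀ t, 0 ≤ t → (Λ t = 0 ↔ t = 0)
  tendsto_zero : Tendsto (fun t => Λ t / t) (𝓝[>] 0) (𝓝 0)
  tendsto_atTop : Tendsto (fun t => Λ t / t) atTop atTop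

/-- The lower index `i_g = inf_{t>0} t g'(t) / g(t)`, as an extended real number. -/
def lowerIndex (g : ℝ → ℝ) : EReal :=
  ⨅ t ∈ Ioi (0 : ℝ), ((t * deriv g t / g t : ℝ) : EReal)

/-- The upper index `s_g = sup_{t>0} t g'(t) / g(t)`, as an extended real number. -/
def upperIndex (g : ℝ → ℝ) : EReal :=
  ⨆ t ∈ Ioi (0 : ℝ), ((t * deriv g t / g t : ℝ) : EReal)

/-- The ellipticity hypothesis on `Φ` in dimension `N`, where `φ = Φ' = deriv Φ`:
`Φ` is a Young function, `C²` in `(0,∞)`, `0 < i_φ ≤ s_φ < ∞` and `s_Φ < N`. -/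
structure IsElliptic (N : ℕ) (Φ : ℝ → ℝ) : Prop where
  young : IsYoungFunction Φ
  contDiffOn : ContDiffOn ℝ 2 Φ (Ioi 0)
  lowerIndex_pos : 0 < lowerIndex (deriv Φ)
  upperIndex_lt_top : upperIndex (deriv Φ) < ⊤
  upperIndex_lt_dim : upperIndex Φ < ((N : ℝ) : EReal)

/-- The inverse `φ⁻¹` of `φ = Φ' : (0,∞) → (0,∞)`. -/
def derivInv (Φ : ℝ → ℝ) : ℝ → ℝ :=
  Function.invFunOn (deriv Φ) (Ioi 0)

/-- The function `H(t) = (∫₀ᵗ (τ / Λ(τ))^{N' - 1} dτ)^{1/N'}`, where `N' = N / (N - 1)`,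
so that `N' - 1 = 1 / (N - 1)` and `1 / N' = (N - 1) / N`. -/
def sobolevAux (N : ℕ) (Λ : ℝ → ℝ) (t : ℝ) : ℝ :=
  (∫ τ in Ioc 0 t, (τ / Λ τ) ^ (1 / ((N : ℝ) - 1))) ^ (((N : ℝ) - 1) / N)

/-- The Sobolev conjugate `Λ_* = Λ ∘ H⁻¹` of `Λ` in dimension `N`. -/
def sobolevConj (N : ℕ) (Λ : ℝ → ℝ) (t : ℝ) : ℝ :=
  Λ (Function.invFunOn (sobolevAux N Λ) (Ici 0) t)

section Orlicz

variable {X F : Type*} [MeasurableSpace X] [NormedAddCommGroup F]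

/-- The Orlicz class `L^Λ(μ)`. -/
def MemOrlicz (Λ : ℝ → ℝ) (μ : Measure X) (f : X → F) : Prop :=
  AEStronglyMeasurable f μ ∧ ∫⁻ x, ENNReal.ofReal (Λ ‖f x‖) ∂μ < ⊤

/-- The Luxemburg norm of `L^Λ(μ)`, with value `∞` if no `τ` is admissible. -/
def luxemburgNorm (Λ : ℝ → ℝ) (μ : Measure X) (f : X → F) : ℝ≥0∞ :=
  ⨅ (τ : ℝ) (_ : 0 < τ ∧ ∫⁻ x, ENNReal.ofReal (Λ (‖f x‖ / τ)) ∂μ ≤ 1), ENNReal.ofReal τ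

end Orlicz

section Space

variable {N : ℕ}

/-- `ξ ∈ C_c^∞(Ω)`, `ξ` being extended by `0` to the whole space. -/
def IsTestFunction (Ω : Set (EuclideanSpace ℝ (Fin N))) (ξ : EuclideanSpace ℝ (Fin N) → ℝ) :
    Prop :=
  ContDiff ℝ ∞ ξ ∧ HasCompactSupport ξ ∧ tsupport ξ ⊆ Ω

/-- `G ∈ L¹_loc(Ω)` is the weak gradient in the open set `Ω` of `u ∈ L¹_loc(Ω)`. -/
def IsWeakGradientOn (Ω : Set (EuclideanSpace ℝ (Fin N))) (u : EuclideanSpace ℝ (Fin N) → ℝ)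
    (G : EuclideanSpace ℝ (Fin N) → EuclideanSpace ℝ (Fin N)) : Prop :=
  LocallyIntegrableOn u Ω volume ∧ LocallyIntegrableOn G Ω volume ∧
    ∀ ξ, IsTestFunction Ω ξ → ∫ x in Ω, u x • ∇ ξ x = -∫ x in Ω, ξ x • G x

/-- `u ∈ D^{1,Λ}_0(Ω)`, where `Ω` is the whole space or an exterior domain: `u ∈ L^{Λ_*}(Ω)`,
`|∇u| ∈ L^Λ(Ω)`, and `u` lies in the closure, under the norm `‖∇u‖_{L^Λ(Ω)}`, of the restrictions
to `Ω` of the functions in `C_c^∞(ℝ^N)`. No condition is imposed on the boundary of `Ω`. -/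
def MemBeppoLevi (Λ : ℝ → ℝ) (Ω : Set (EuclideanSpace ℝ (Fin N)))
    (u : EuclideanSpace ℝ (Fin N) → ℝ) : Prop :=
  MemOrlicz (sobolevConj N Λ) (volume.restrict Ω) u ∧
    ∃ G, IsWeakGradientOn Ω u G ∧ MemOrlicz Λ (volume.restrict Ω) G ∧
      ∃ ξ : ℕ → EuclideanSpace ℝ (Fin N) → ℝ, (∀ n, IsTestFunction univ (ξ n)) ∧
        Tendsto (fun n => luxemburgNorm Λ (volume.restrict Ω) (fun x => ∇ (ξ n) x - G x))
          atTop (𝓝 0)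

/-- The vector field `φ(|v|) v / |v|` (equal to `0` at `v = 0`), where `φ = Φ'`. -/
def phiFlux (Φ : ℝ → ℝ) (v : EuclideanSpace ℝ (Fin N)) : EuclideanSpace ℝ (Fin N) :=
  (deriv Φ ‖v‖ / ‖v‖) • v

/-- `Δ_Φ u = div (φ(|∇u|) ∇u / |∇u|) = 0` in the open set `Ω`, in the sense of distributions. -/
def IsPhiHarmonicOn (Φ : ℝ → ℝ) (Ω : Set (EuclideanSpace ℝ (Fin N)))
    (u : EuclideanSpace ℝ (Fin N) → ℝ) : Prop :=
  ∃ G, IsWeakGradientOn Ω u G ∧ LocallyIntegrableOn (fun x => phiFlux Φ (G x)) Ω volume ∧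
    ∀ ξ, IsTestFunction Ω ξ → ∫ x in Ω, ⟪phiFlux Φ (G x), ∇ ξ x⟫ = 0

end Space

end

/-!
The argument rests on one notion, `HasPowerGrowth`: a positive function on `(0,∞)` which, under a
dilation by `l ≥ 1`, grows at least like `l ^ α` and at most like `l ^ β`, with `0 < α`. Such a
function is a homeomorphism of `(0,∞)`, and its inverse is of the same kind. By integration of the
index inequalities, `φ = Φ'` has power growth (`EllipticBounds.growth`), hence so does `φ⁻¹`, and
hence so does `k ↦ ∫_r^∞ φ⁻¹(k s^{1-N}) ds` (`radialProfile_growth`). This gives existence and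
uniqueness of `k`.

Convergence of the integrals comes from `t φ(t) ≤ q Φ(t)` with `1 < q < N`: the slope
`g(s) = φ⁻¹(k s^{1-N})` decays like `s^{-β}` with `β = (N-1)/(q-1) > 1` (`radialSlope_mul_le`), so
that `W(s) = ∫_s^∞ g` is at most a multiple of `s g(s)`. The modular `∫ Φ(|∇w|)` of
`w(x) = W(|x|)` outside `B_r` is finite since `Φ(g) ≤ g φ(g) = k g s^{1-N}`, which decays like
`s^{1-N-β}`. For the Sobolev conjugate, `s^N Φ(g(s))` is bounded, so
`W ≤ C s g ≤ C' g Φ(g)^{-1/N} ≤ C' 𝓗(g)`, the last step because the integrand in `𝓗` decreases; as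
`𝓗` has power growth, `Φ_*(W) ≤ C'' Φ(g)` (`exists_sobolevConj_radialProfile_le`).

Away from the origin `w` is `C¹` with `∇w = -g(|x|) x/|x|`, and its flux is exactly `-k x/|x|^N`,
which is divergence free there; the equation follows by integration by parts. Finally, radial test
functions approximating `w` are obtained by integrating smooth, compactly supported approximations
of `g`; dominated convergence and the `Δ₂` condition turn this into Luxemburg-norm convergence of
the gradients (`memBeppoLevi_radialProfile`).
-/

/-! ### Functions of power growth -/

/-- A positive function on `(0,∞)` lying between two positive powers under dilations:
`l ^ α * f t ≤ f (l * t) ≤ l ^ β * f t` for `l ≥ 1`. Values outside `(0,∞)` are irrelevant. -/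
structure HasPowerGrowth (f : ℝ → ℝ) (α β : ℝ) : Prop where
  exponent_pos : 0 < α
  pos : ∀ t, 0 < t → 0 < f t
  lower : ∀ l t, 1 ≤ l → 0 < t → l ^ α * f t ≤ f (l * t)
  upper : ∀ l t, 1 ≤ l → 0 < t → f (l * t) ≤ l ^ β * f t

namespace HasPowerGrowth

variable {f : ℝ → ℝ} {α β : ℝ}

lemma exponent_le (h : HasPowerGrowth f α β) : α ≤ β := by
  have h1 := (h.lower 2 1 (by norm_num) one_pos).trans (h.upper 2 1 (by norm_num) one_pos)
  have h2 := le_of_mul_le_mul_right h1 (h.pos 1 one_pos)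
  exact (Real.rpow_le_rpow_left_iff (by norm_num)).1 h2

lemma upper_exponent_pos (h : HasPowerGrowth f α β) : 0 < β :=
  h.exponent_pos.trans_le h.exponent_le

lemma strictMonoOn (h : HasPowerGrowth f α β) : StrictMonoOn f (Ioi 0) := by
  intro s hs t ht hst
  have hs' : 0 < s := hs
  have h1 : 1 < t / s := (one_lt_div hs').2 hst
  have h2 := h.lower (t / s) s h1.le hs'
  rw [div_mul_cancel₀ _ hs'.ne'] at h2
  have h3 := Real.one_lt_rpow h1 h.exponent_pos
  nlinarith [h.pos s hs']

lemma le_of_le_one (h : HasPowerGrowth f α β) {l t : ℝ} (hl : 0 < l) (hl1 : l ≤ 1) (ht : 0 < t) :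
    f (l * t) ≤ l ^ α * f t := by
  have h1 := h.lower l⁻¹ (l * t) ((one_le_inv₀ hl).2 hl1) (by positivity)
  rw [inv_mul_cancel_left₀ hl.ne', Real.inv_rpow hl.le] at h1
  have := Real.rpow_pos_of_pos hl α
  rwa [inv_mul_le_iff₀ this] at h1

lemma ge_of_le_one (h : HasPowerGrowth f α β) {l t : ℝ} (hl : 0 < l) (hl1 : l ≤ 1) (ht : 0 < t) :
    l ^ β * f t ≤ f (l * t) := by
  have h1 := h.upper l⁻¹ (l * t) ((one_le_inv₀ hl).2 hl1) (by positivity)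
  rw [inv_mul_cancel_left₀ hl.ne', Real.inv_rpow hl.le] at h1
  have := Real.rpow_pos_of_pos hl β
  rwa [le_inv_mul_iff₀ this] at h1

lemma continuousOn (h : HasPowerGrowth f α β) : ContinuousOn f (Ioi 0) := by
  intro t ht
  have ht' : 0 < t := ht
  -- Squeeze `f s` between `f t` times the smaller and the larger of `(s / t) ^ α`, `(s / t) ^ β`.
  have key : ∀ γ : ℝ, Tendsto (fun s => (s / t) ^ γ) (𝓝[Ioi 0] t) (𝓝 1) := by
    intro γ
    have : ContinuousAt (fun s => (s / t) ^ γ) t := by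
      refine ContinuousAt.rpow_const (by fun_prop) (Or.inl ?_)
      simp [ht'.ne']
    have h2 := this.tendsto
    simp only [div_self ht'.ne', Real.one_rpow] at h2
    exact h2.mono_left nhdsWithin_le_nhds
  have lo := ((key α).min (key β)).mul_const (f t)
  have hi := ((key α).max (key β)).mul_const (f t)
  simp only [min_self, max_self, one_mul] at lo hi
  refine tendsto_of_tendsto_of_tendsto_of_le_of_le' lo hi ?_ ?_
  · filter_upwards [self_mem_nhdsWithin] with s hs
    have hs' : 0 < s := hs
    have e : s / t * t = s := div_mul_cancel₀ _ ht'.ne'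
    have hf := h.pos t ht'
    rcases le_total 1 (s / t) with h1 | h1
    · have := h.lower _ t h1 ht'
      rw [e] at this
      exact (mul_le_mul_of_nonneg_right (min_le_left _ _) hf.le).trans this
    · have := h.ge_of_le_one (by positivity) h1 ht'
      rw [e] at this
      exact (mul_le_mul_of_nonneg_right (min_le_right _ _) hf.le).trans this
  · filter_upwards [self_mem_nhdsWithin] with s hs
    have hs' : 0 < s := hs
    have e : s / t * t = s := div_mul_cancel₀ _ ht'.ne'
    have hf := h.pos t ht'
    rcases le_total 1 (s / t) with h1 | h1
    · have := h.upper _ t h1 ht'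
      rw [e] at this
      exact this.trans (mul_le_mul_of_nonneg_right (le_max_right _ _) hf.le)
    · have := h.le_of_le_one (by positivity) h1 ht'
      rw [e] at this
      exact this.trans (mul_le_mul_of_nonneg_right (le_max_left _ _) hf.le)

lemma exists_eq (h : HasPowerGrowth f α β) {y : ℝ} (hy : 0 < y) : ∃ t, 0 < t ∧ f t = y := by
  have h1 := h.pos 1 one_pos
  have hα := h.exponent_pos
  -- The points at which the lower growth bound forces `f` below, resp. above, `y`.
  set a : ℝ := (min 1 (y / f 1)) ^ α⁻¹ with ha
  set b : ℝ := (max 1 (y / f 1)) ^ α⁻¹ with hb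
  have hm : 0 < min 1 (y / f 1) := lt_min one_pos (by positivity)
  have hM : 0 < max 1 (y / f 1) := lt_max_of_lt_left one_pos
  have ha0 : 0 < a := Real.rpow_pos_of_pos hm _
  have ha1 : a ≤ 1 := Real.rpow_le_one hm.le (min_le_left _ _) (by positivity)
  have hb1 : 1 ≤ b := Real.one_le_rpow (le_max_left _ _) (by positivity)
  have haα : a ^ α = min 1 (y / f 1) := by
    rw [ha, ← Real.rpow_mul hm.le, inv_mul_cancel₀ hα.ne', Real.rpow_one]
  have hbα : b ^ α = max 1 (y / f 1) := by
    rw [hb, ← Real.rpow_mul hM.le, inv_mul_cancel₀ hα.ne', Real.rpow_one]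
  have hfa : f a ≤ y := by
    have := h.le_of_le_one ha0 ha1 one_pos
    rw [mul_one, haα] at this
    refine this.trans ((mul_le_mul_of_nonneg_right (min_le_right _ _) h1.le).trans ?_)
    rw [div_mul_cancel₀ _ h1.ne']
  have hfb : y ≤ f b := by
    have := h.lower b 1 hb1 one_pos
    rw [mul_one, hbα] at this
    refine le_trans ?_ ((mul_le_mul_of_nonneg_right (le_max_right _ _) h1.le).trans this)
    rw [div_mul_cancel₀ _ h1.ne']
  have hsub : Icc a b ⊆ Ioi 0 := fun x hx => ha0.trans_le hx.1
  obtain ⟨t, ht, hty⟩ := intermediate_value_Icc (ha1.trans hb1) (h.continuousOn.mono hsub)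
    ⟨hfa, hfb⟩
  exact ⟨t, hsub ht, hty⟩

lemma le_iff_le (h : HasPowerGrowth f α β) {s t : ℝ} (hs : 0 < s) (ht : 0 < t) :
    f s ≤ f t ↔ s ≤ t :=
  h.strictMonoOn.le_iff_le hs ht

/-- A right inverse on `(0,∞)` of a function of power growth is again of power growth, with the
reciprocal exponents. -/
lemma rightInverse (h : HasPowerGrowth f α β) {g : ℝ → ℝ}
    (hg : ∀ y, 0 < y → 0 < g y ∧ f (g y) = y) : HasPowerGrowth g β⁻¹ α⁻¹ where
  exponent_pos := inv_pos.2 h.upper_exponent_pos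
  pos y hy := (hg y hy).1
  lower l y hl hy := by
    have hl0 : 0 < l := one_pos.trans_le hl
    obtain ⟨h0, h1⟩ := hg y hy
    obtain ⟨h2, h3⟩ := hg (l * y) (by positivity)
    have hp : 0 < l ^ β⁻¹ := Real.rpow_pos_of_pos hl0 _
    rw [← h.le_iff_le (by positivity) h2, h3]
    have := h.upper (l ^ β⁻¹) (g y)
      (Real.one_le_rpow hl (inv_pos.2 h.upper_exponent_pos).le) h0
    rwa [← Real.rpow_mul hl0.le, inv_mul_cancel₀ h.upper_exponent_pos.ne', Real.rpow_one, h1]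
      at this
  upper l y hl hy := by
    have hl0 : 0 < l := one_pos.trans_le hl
    obtain ⟨h0, h1⟩ := hg y hy
    obtain ⟨h2, h3⟩ := hg (l * y) (by positivity)
    have hp : 0 < l ^ α⁻¹ := Real.rpow_pos_of_pos hl0 _
    rw [← h.le_iff_le h2 (by positivity), h3]
    have := h.lower (l ^ α⁻¹) (g y) (Real.one_le_rpow hl (inv_pos.2 h.exponent_pos).le) h0
    rwa [← Real.rpow_mul hl0.le, inv_mul_cancel₀ h.exponent_pos.ne', Real.rpow_one, h1] at this

end HasPowerGrowth

lemma rpow_mul_le_of_mul_le_mul_deriv {f f' : ℝ → ℝ} {a : ℝ}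
    (hf : ∀ t, 0 < t → HasDerivAt f (f' t) t) (h : ∀ t, 0 < t → a * f t ≤ t * f' t)
    {l t : ℝ} (hl : 1 ≤ l) (ht : 0 < t) : l ^ a * f t ≤ f (l * t) := by
  have hd : ∀ s, 0 < s → HasDerivAt (fun s => s ^ (-a) * f s)
      ((-a) * s ^ (-a - 1) * f s + s ^ (-a) * f' s) s := fun s hs =>
    (Real.hasDerivAt_rpow_const (Or.inl hs.ne')).mul (hf s hs)
  have hmono : MonotoneOn (fun s => s ^ (-a) * f s) (Ioi 0) := by
    refine monotoneOn_of_deriv_nonneg (convex_Ioi 0)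
      (fun s hs => (hd s hs).continuousAt.continuousWithinAt) ?_ ?_
    · rw [interior_Ioi]
      exact fun s hs => (hd s hs).differentiableAt.differentiableWithinAt
    · rw [interior_Ioi]
      intro s hs
      have hs' : 0 < s := hs
      rw [(hd s hs).deriv]
      have e : s ^ (-a) = s ^ (-a - 1) * s := by
        rw [← Real.rpow_add_one hs'.ne']; ring_nf
      rw [e]
      have := Real.rpow_pos_of_pos hs' (-a - 1)
      nlinarith [h s hs]
  have hl0 : 0 < l := one_pos.trans_le hl
  have h1 : t ^ (-a) * f t ≤ (l * t) ^ (-a) * f (l * t) :=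
    hmono ht (mul_pos hl0 ht) (le_mul_of_one_le_left ht.le hl)
  rw [Real.mul_rpow hl0.le ht.le, mul_comm (l ^ (-a)), mul_assoc] at h1
  have h2 := le_of_mul_le_mul_left h1 (Real.rpow_pos_of_pos ht _)
  rw [Real.rpow_neg hl0.le] at h2
  have := Real.rpow_pos_of_pos hl0 a
  rwa [le_inv_mul_iff₀ this] at h2

lemma le_rpow_mul_of_mul_deriv_le_mul {f f' : ℝ → ℝ} {b : ℝ}
    (hf : ∀ t, 0 < t → HasDerivAt f (f' t) t) (h : ∀ t, 0 < t → t * f' t ≤ b * f t)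
    {l t : ℝ} (hl : 1 ≤ l) (ht : 0 < t) : f (l * t) ≤ l ^ b * f t := by
  have := rpow_mul_le_of_mul_le_mul_deriv (f := fun s => -f s) (f' := fun s => -f' s) (a := b)
    (fun s hs => (hf s hs).neg) (fun s hs => by linarith [h s hs]) hl ht
  simp only [mul_neg] at this
  linarith

/-! ### Quantitative form of the ellipticity hypothesis -/

/-- The hypotheses on `Φ` in quantitative form: `φ = Φ'` lies between the powers `a` and `b`, and
`Φ t ≤ t φ(t) ≤ q Φ t` with `1 < q < N`. -/
structure EllipticBounds (N : ℕ) (Φ : ℝ → ℝ) (a b q : ℝ) : Prop where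
  growth : HasPowerGrowth (deriv Φ) a b
  one_lt : 1 < q
  lt_dim : q < N
  zero : Φ 0 = 0
  pos : ∀ t, 0 < t → 0 < Φ t
  hasDerivAt : ∀ t, 0 < t → HasDerivAt Φ (deriv Φ t) t
  le_mul_deriv : ∀ t, 0 < t → Φ t ≤ t * deriv Φ t
  mul_deriv_le : ∀ t, 0 < t → t * deriv Φ t ≤ q * Φ t

lemma IsElliptic.exists_bounds {N : ℕ} {Φ : ℝ → ℝ} (h : IsElliptic N Φ) :
    ∃ a b q, EllipticBounds N Φ a b q := by
  have hzero : Φ 0 = 0 := (h.young.eq_zero_iff 0 le_rfl).2 rfl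
  have hpos : ∀ t, 0 < t → 0 < Φ t := fun t ht =>
    lt_of_le_of_ne (h.young.nonneg t ht.le) fun e => ht.ne' ((h.young.eq_zero_iff t ht.le).1 e.symm)
  have hderiv : ∀ t, 0 < t → HasDerivAt Φ (deriv Φ t) t := fun t ht =>
    ((h.contDiffOn.differentiableOn (by norm_num)).differentiableAt (Ioi_mem_nhds ht)).hasDerivAt
  have hC1 : ContDiffOn ℝ 1 (deriv Φ) (Ioi 0) :=
    ((contDiffOn_succ_iff_deriv_of_isOpen (n := 1) isOpen_Ioi).1
      (by simpa [one_add_one_eq_two] using h.contDiffOn)).2.2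
  have hderiv2 : ∀ t, 0 < t → HasDerivAt (deriv Φ) (deriv (deriv Φ) t) t := fun t ht =>
    ((hC1.differentiableOn (by norm_num)).differentiableAt (Ioi_mem_nhds ht)).hasDerivAt
  have hle : ∀ t, 0 < t → Φ t ≤ t * deriv Φ t := by
    intro t ht
    have h1 := h.young.convexOn.slope_le_of_hasDerivAt (x := 0) (y := t) (by simp)
      (by simpa using ht.le) ht (hderiv t ht)
    rw [slope_def_field, hzero, sub_zero, sub_zero, div_le_iff₀ ht] at h1
    linarith
  have hφ : ∀ t, 0 < t → 0 < deriv Φ t := fun t ht =>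
    pos_of_mul_pos_right ((hpos t ht).trans_le (hle t ht)) ht.le
  obtain ⟨a, ha0, ha⟩ := EReal.lt_iff_exists_real_btwn.1 h.lowerIndex_pos
  obtain ⟨b, hb, -⟩ := EReal.lt_iff_exists_real_btwn.1 h.upperIndex_lt_top
  obtain ⟨q, hq, hqN⟩ := EReal.lt_iff_exists_real_btwn.1 h.upperIndex_lt_dim
  have ha0 : 0 < a := by exact_mod_cast ha0
  have hqN : q < N := by exact_mod_cast hqN
  have hA : ∀ t, 0 < t → a * deriv Φ t ≤ t * deriv (deriv Φ) t := by
    intro t ht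
    have h1 : (a : EReal) ≤ ((t * deriv (deriv Φ) t / deriv Φ t : ℝ) : EReal) :=
      ha.le.trans (iInf₂_le (f := fun t (_ : t ∈ Ioi (0 : ℝ)) =>
        ((t * deriv (deriv Φ) t / deriv Φ t : ℝ) : EReal)) t ht)
    exact (le_div_iff₀ (hφ t ht)).1 (EReal.coe_le_coe_iff.1 h1)
  have hB : ∀ t, 0 < t → t * deriv (deriv Φ) t ≤ b * deriv Φ t := by
    intro t ht
    have h1 : ((t * deriv (deriv Φ) t / deriv Φ t : ℝ) : EReal) ≤ (b : EReal) :=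
      (le_iSup₂ (f := fun t (_ : t ∈ Ioi (0 : ℝ)) =>
        ((t * deriv (deriv Φ) t / deriv Φ t : ℝ) : EReal)) t ht).trans hb.le
    exact (div_le_iff₀ (hφ t ht)).1 (EReal.coe_le_coe_iff.1 h1)
  have hQ : ∀ t, 0 < t → t * deriv Φ t ≤ q * Φ t := by
    intro t ht
    have h1 : ((t * deriv Φ t / Φ t : ℝ) : EReal) ≤ (q : EReal) :=
      (le_iSup₂ (f := fun t (_ : t ∈ Ioi (0 : ℝ)) =>
        ((t * deriv Φ t / Φ t : ℝ) : EReal)) t ht).trans hq.le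
    exact (div_le_iff₀ (hpos t ht)).1 (EReal.coe_le_coe_iff.1 h1)
  have hG : HasPowerGrowth (deriv Φ) a b :=
    ⟨ha0, hφ, fun l t hl ht => rpow_mul_le_of_mul_le_mul_deriv hderiv2 hA hl ht,
      fun l t hl ht => le_rpow_mul_of_mul_deriv_le_mul hderiv2 hB hl ht⟩
  refine ⟨a, b, q, hG, ?_, hqN, hzero, hpos, hderiv, hle, hQ⟩
  -- `φ` is strictly increasing, so `Φ 1 < φ 1` by the mean value theorem on `[1/2, 1]`.
  obtain ⟨ξ, hξ, hξe⟩ := exists_hasDerivAt_eq_slope Φ (deriv Φ) (a := 1 / 2) (b := 1)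
    (by norm_num)
    (fun s hs => (hderiv s (by linarith [hs.1])).continuousAt.continuousWithinAt)
    (fun s hs => hderiv s (by linarith [hs.1]))
  have h1 := hG.strictMonoOn (show (0 : ℝ) < ξ by linarith [hξ.1]) (show (0 : ℝ) < 1 by norm_num)
    hξ.2
  have h2 := hG.strictMonoOn (show (0 : ℝ) < 1 / 2 by norm_num) (show (0 : ℝ) < 1 by norm_num)
    (by norm_num)
  have h3 := hle (1 / 2) (by norm_num)
  have h4 := hQ 1 one_pos
  have h5 := hpos 1 one_pos
  rw [hξe] at h1
  norm_num at h1
  nlinarith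

namespace EllipticBounds

variable {N : ℕ} {Φ : ℝ → ℝ} {a b q : ℝ}

lemma dim_sub_one_pos (h : EllipticBounds N Φ a b q) : (0 : ℝ) < N - 1 := by
  linarith [h.one_lt, h.lt_dim]

lemma nonneg (h : EllipticBounds N Φ a b q) {t : ℝ} (ht : 0 ≤ t) : 0 ≤ Φ t := by
  rcases ht.eq_or_lt with rfl | ht
  · exact h.zero.ge
  · exact (h.pos t ht).le

/-- Under the elliptic bounds `Φ` itself has power growth; this contains the `Δ₂` condition. -/
lemma young_growth (h : EllipticBounds N Φ a b q) : HasPowerGrowth Φ 1 q where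
  exponent_pos := one_pos
  pos := h.pos
  lower _ _ hl ht := rpow_mul_le_of_mul_le_mul_deriv h.hasDerivAt
    (fun s hs => by linarith [h.le_mul_deriv s hs]) hl ht
  upper _ _ hl ht := le_rpow_mul_of_mul_deriv_le_mul h.hasDerivAt h.mul_deriv_le hl ht

lemma monotoneOn (h : EllipticBounds N Φ a b q) : MonotoneOn Φ (Ici 0) := by
  intro s hs t ht hst
  rcases (mem_Ici.1 hs).eq_or_lt with rfl | hs
  · rw [h.zero]; exact h.nonneg ht
  · exact (h.young_growth.le_iff_le hs (hs.trans_le hst)).2 hst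

lemma continuousOn (h : EllipticBounds N Φ a b q) : ContinuousOn Φ (Ici 0) := by
  intro t ht
  rcases (mem_Ici.1 ht).eq_or_lt with rfl | ht'
  · have h1 : Tendsto (fun t : ℝ => t * Φ 1) (𝓝[Ici 0] 0) (𝓝 (Φ 0)) := by
      have : ContinuousAt (fun t : ℝ => t * Φ 1) 0 := by fun_prop
      have h2 := this.tendsto
      rw [zero_mul] at h2
      rw [h.zero]
      exact h2.mono_left nhdsWithin_le_nhds
    refine tendsto_of_tendsto_of_tendsto_of_le_of_le' (by rw [h.zero]; exact tendsto_const_nhds)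
      h1 ?_ ?_
    · filter_upwards [self_mem_nhdsWithin] with s hs using h.nonneg hs
    · filter_upwards [self_mem_nhdsWithin, nhdsWithin_le_nhds (Iio_mem_nhds one_pos)] with s hs hs1
      rcases (mem_Ici.1 hs).eq_or_lt with rfl | hs'
      · simp [h.zero]
      · simpa using h.young_growth.le_of_le_one hs' (le_of_lt hs1) one_pos
  · exact (h.hasDerivAt t ht').continuousAt.continuousWithinAt

/-- The `Δ₂` condition. -/
lemma young_mul_le (h : EllipticBounds N Φ a b q) {l t : ℝ} (hl : 1 ≤ l) (ht : 0 ≤ t) :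
    Φ (l * t) ≤ l ^ q * Φ t := by
  rcases ht.eq_or_lt with rfl | ht
  · simp [h.zero]
  · exact h.young_growth.upper l t hl ht

/-! ### The inverse of `φ` -/

lemma derivInv_spec (h : EllipticBounds N Φ a b q) (y : ℝ) (hy : 0 < y) :
    0 < derivInv Φ y ∧ deriv Φ (derivInv Φ y) = y := by
  obtain ⟨t, ht, hty⟩ := h.growth.exists_eq hy
  exact Function.invFunOn_pos (f := deriv Φ) (s := Ioi 0) (b := y) ⟨t, ht, hty⟩

lemma derivInv_growth (h : EllipticBounds N Φ a b q) :
    HasPowerGrowth (derivInv Φ) b⁻¹ a⁻¹ :=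
  h.growth.rightInverse h.derivInv_spec

/-- Decay of `φ⁻¹` near `0`: up to a constant `φ` grows at most like the power `q - 1`, so `φ⁻¹`
decreases at least like the power `1 / (q - 1)` when its argument is divided by `ν`. -/
lemma derivInv_div_le (h : EllipticBounds N Φ a b q) {ν y : ℝ} (hν : 1 ≤ ν) (hy : 0 < y) :
    derivInv Φ (y / ν) ≤ (q / ν) ^ (q - 1)⁻¹ * derivInv Φ y := by
  have hν0 : 0 < ν := one_pos.trans_le hν
  have hq1 : 0 < q - 1 := by linarith [h.one_lt]
  have hq0 : 0 < q := by linarith [h.one_lt]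
  obtain ⟨h0, h1⟩ := h.derivInv_spec y hy
  obtain ⟨h2, h3⟩ := h.derivInv_spec (y / ν) (by positivity)
  rcases le_total ν q with hνq | hνq
  · have hA : derivInv Φ (y / ν) ≤ derivInv Φ y :=
      (h.derivInv_growth.le_iff_le (by positivity) hy).2 (div_le_self hy.le hν)
    have hB : 1 ≤ (q / ν) ^ (q - 1)⁻¹ :=
      Real.one_le_rpow ((one_le_div hν0).2 hνq) (by positivity)
    nlinarith
  · set c := (q / ν) ^ (q - 1)⁻¹ with hc
    have hqν : 0 < q / ν := by positivity
    have hc0 : 0 < c := Real.rpow_pos_of_pos hqν _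
    have hc1 : c ≤ 1 := Real.rpow_le_one hqν.le ((div_le_one hν0).2 hνq) (by positivity)
    set t := c * derivInv Φ y with ht
    have ht0 : 0 < t := by positivity
    rw [← h.growth.le_iff_le h2 ht0, h3]
    have e : c⁻¹ * t = derivInv Φ y := inv_mul_cancel_left₀ hc0.ne' _
    have u1 := h.le_mul_deriv (derivInv Φ y) h0
    have u2 := h.mul_deriv_le _ h0
    have u3 := h.young_growth.upper c⁻¹ t ((one_le_inv₀ hc0).2 hc1) ht0
    have u4 := h.le_mul_deriv t ht0
    have hcq : c⁻¹ ^ q = c⁻¹ * (ν / q) := by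
      rw [show q = (q - 1) + 1 by ring, Real.rpow_add_one (inv_pos.2 hc0).ne', mul_comm,
        sub_add_cancel]
      congr 1
      rw [Real.inv_rpow hc0.le, hc, ← Real.rpow_mul hqν.le, inv_mul_cancel₀ hq1.ne',
        Real.rpow_one, inv_div]
    rw [e] at u3
    rw [h1] at u2
    rw [hcq] at u3
    have u5 : c⁻¹ * (t * y) ≤ c⁻¹ * (t * (ν * deriv Φ t)) := by
      calc c⁻¹ * (t * y) = derivInv Φ y * y := by rw [← e]; ring
        _ ≤ q * (c⁻¹ * (ν / q) * Φ t) := u2.trans (mul_le_mul_of_nonneg_left u3 hq0.le)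
        _ = c⁻¹ * ν * Φ t := by field_simp
        _ ≤ c⁻¹ * ν * (t * deriv Φ t) := by gcongr
        _ = _ := by ring
    have u6 := le_of_mul_le_mul_left (le_of_mul_le_mul_left u5 (inv_pos.2 hc0)) ht0
    rwa [div_le_iff₀' hν0]

end EllipticBounds

/-! ### The radial slope and its primitive -/

/-- The slope `s ↦ φ⁻¹(k s^{1-N})` of the radial solution. -/
noncomputable def radialSlope (N : ℕ) (Φ : ℝ → ℝ) (k s : ℝ) : ℝ :=
  derivInv Φ (k * s ^ (1 - (N : ℝ)))

/-- The radial profile `s ↦ ∫_s^∞ φ⁻¹(k σ^{1-N}) dσ`. -/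
noncomputable def radialProfile (N : ℕ) (Φ : ℝ → ℝ) (k s : ℝ) : ℝ :=
  ∫ σ in Ioi s, radialSlope N Φ k σ

namespace EllipticBounds

variable {N : ℕ} {Φ : ℝ → ℝ} {a b q k r s : ℝ}

lemma radialSlope_pos (h : EllipticBounds N Φ a b q) (hk : 0 < k) (hs : 0 < s) :
    0 < radialSlope N Φ k s :=
  (h.derivInv_spec _ (mul_pos hk (Real.rpow_pos_of_pos hs _))).1

lemma deriv_radialSlope (h : EllipticBounds N Φ a b q) (hk : 0 < k) (hs : 0 < s) :
    deriv Φ (radialSlope N Φ k s) = k * s ^ (1 - (N : ℝ)) :=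
  (h.derivInv_spec _ (mul_pos hk (Real.rpow_pos_of_pos hs _))).2

lemma continuousOn_radialSlope (h : EllipticBounds N Φ a b q) (hk : 0 < k) :
    ContinuousOn (radialSlope N Φ k) (Ioi 0) := by
  refine h.derivInv_growth.continuousOn.comp
    (f := fun s : ℝ => k * s ^ (1 - (N : ℝ))) ?_ ?_
  · exact continuousOn_const.mul
      (continuousOn_id.rpow_const fun s hs => Or.inl (ne_of_gt hs))
  · exact fun s hs => mul_pos hk (Real.rpow_pos_of_pos hs _)

lemma one_lt_decay (h : EllipticBounds N Φ a b q) : 1 < ((N : ℝ) - 1) / (q - 1) := by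
  rw [one_lt_div (by linarith [h.one_lt])]
  linarith [h.lt_dim]

/-- The slope decays faster than `1 / s`, by the factor `(N - 1) / (q - 1) > 1`. -/
lemma radialSlope_mul_le (h : EllipticBounds N Φ a b q) (hk : 0 < k) (hs : 0 < s) {μ : ℝ}
    (hμ : 1 ≤ μ) : radialSlope N Φ k (μ * s) ≤
      q ^ (q - 1)⁻¹ * radialSlope N Φ k s * μ ^ (-(((N : ℝ) - 1) / (q - 1))) := by
  have hμ0 : 0 < μ := one_pos.trans_le hμ
  have hq0 : 0 < q := by linarith [h.one_lt]
  have h1 := h.derivInv_div_le (ν := μ ^ ((N : ℝ) - 1)) (y := k * s ^ (1 - (N : ℝ)))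
    (Real.one_le_rpow hμ h.dim_sub_one_pos.le) (mul_pos hk (Real.rpow_pos_of_pos hs _))
  have e1 : k * s ^ (1 - (N : ℝ)) / μ ^ ((N : ℝ) - 1) = k * (μ * s) ^ (1 - (N : ℝ)) := by
    rw [Real.mul_rpow hμ0.le hs.le, show (1 - (N : ℝ)) = -((N : ℝ) - 1) by ring,
      Real.rpow_neg hμ0.le]
    ring
  have e2 : (q / μ ^ ((N : ℝ) - 1)) ^ (q - 1)⁻¹
      = q ^ (q - 1)⁻¹ * μ ^ (-(((N : ℝ) - 1) / (q - 1))) := by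
    rw [Real.div_rpow hq0.le (Real.rpow_nonneg hμ0.le _), ← Real.rpow_mul hμ0.le,
      Real.rpow_neg hμ0.le]
    rfl
  rw [e1, e2] at h1
  unfold radialSlope
  linarith

lemma radialSlope_le (h : EllipticBounds N Φ a b q) (hk : 0 < k) (hr : 0 < r) (hs : r ≤ s) :
    radialSlope N Φ k s ≤ q ^ (q - 1)⁻¹ * radialSlope N Φ k r *
      r ^ (((N : ℝ) - 1) / (q - 1)) * s ^ (-(((N : ℝ) - 1) / (q - 1))) := by
  have h1 := h.radialSlope_mul_le hk hr ((one_le_div hr).2 hs)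
  rw [div_mul_cancel₀ _ hr.ne', Real.div_rpow (hr.le.trans hs) hr.le,
    Real.rpow_neg hr.le, div_inv_eq_mul] at h1
  linarith

lemma integrableOn_radialSlope (h : EllipticBounds N Φ a b q) (hk : 0 < k) (hr : 0 < r) :
    IntegrableOn (radialSlope N Φ k) (Ioi r) := by
  have h1 : IntegrableOn (fun s : ℝ => q ^ (q - 1)⁻¹ * radialSlope N Φ k r *
      r ^ (((N : ℝ) - 1) / (q - 1)) * s ^ (-(((N : ℝ) - 1) / (q - 1)))) (Ioi r) :=
    (integrableOn_Ioi_rpow_of_lt (by linarith [h.one_lt_decay]) hr).const_mul _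
  refine Integrable.mono' h1 ?_ ?_
  · exact ((h.continuousOn_radialSlope hk).mono (Ioi_subset_Ioi hr.le)).aestronglyMeasurable
      measurableSet_Ioi
  · filter_upwards [ae_restrict_mem measurableSet_Ioi] with s hs
    rw [Real.norm_of_nonneg (h.radialSlope_pos hk (hr.trans hs)).le]
    exact h.radialSlope_le hk hr (le_of_lt hs)

lemma radialProfile_pos (h : EllipticBounds N Φ a b q) (hk : 0 < k) (hr : 0 < r) :
    0 < radialProfile N Φ k r := by
  have hpos : ∀ s ∈ Ioi r, 0 < radialSlope N Φ k s := fun s hs =>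
    h.radialSlope_pos hk (hr.trans hs)
  rw [radialProfile, setIntegral_pos_iff_support_of_nonneg_ae
    ((ae_restrict_mem measurableSet_Ioi).mono fun s hs => (hpos s hs).le)
    (h.integrableOn_radialSlope hk hr)]
  have : Function.support (radialSlope N Φ k) ∩ Ioi r = Ioi r :=
    inter_eq_right.2 fun s hs => (hpos s hs).ne'
  simp [this]

/-- As a function of the parameter `k`, the profile inherits the power growth of `φ⁻¹`. This gives
existence and uniqueness of the parameter with a prescribed boundary value. -/
lemma radialProfile_growth (h : EllipticBounds N Φ a b q) (hr : 0 < r) :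
    HasPowerGrowth (fun k => radialProfile N Φ k r) b⁻¹ a⁻¹ where
  exponent_pos := h.derivInv_growth.exponent_pos
  pos k hk := h.radialProfile_pos hk hr
  lower l k hl hk := by
    rw [radialProfile, ← integral_const_mul]
    refine setIntegral_mono_on ((h.integrableOn_radialSlope hk hr).const_mul _)
      (h.integrableOn_radialSlope (by positivity) hr) measurableSet_Ioi fun s hs => ?_
    rw [radialSlope, radialSlope, mul_assoc]
    exact h.derivInv_growth.lower l _ hl (mul_pos hk (Real.rpow_pos_of_pos (hr.trans hs) _))
  upper l k hl hk := by
    rw [radialProfile, radialProfile, ← integral_const_mul]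
    refine setIntegral_mono_on (h.integrableOn_radialSlope (by positivity) hr)
      ((h.integrableOn_radialSlope hk hr).const_mul _) measurableSet_Ioi fun s hs => ?_
    rw [radialSlope, radialSlope, mul_assoc]
    exact h.derivInv_growth.upper l _ hl (mul_pos hk (Real.rpow_pos_of_pos (hr.trans hs) _))

/-- The tail of the slope beyond `s` is controlled by its value at `s`. -/
lemma exists_radialProfile_le (h : EllipticBounds N Φ a b q) (hk : 0 < k) :
    ∃ C, 0 < C ∧ ∀ s, 0 < s → radialProfile N Φ k s ≤ C * (s * radialSlope N Φ k s) := by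
  set β := ((N : ℝ) - 1) / (q - 1) with hβ
  have hβ1 : 1 < β := h.one_lt_decay
  have hq0 : 0 < q ^ (q - 1)⁻¹ := Real.rpow_pos_of_pos (by linarith [h.one_lt]) _
  refine ⟨q ^ (q - 1)⁻¹ / (β - 1), div_pos hq0 (by linarith), fun s hs => ?_⟩
  have hint : IntegrableOn (fun σ : ℝ => σ ^ (-β)) (Ioi s) :=
    integrableOn_Ioi_rpow_of_lt (by linarith) hs
  calc radialProfile N Φ k s
      ≤ ∫ σ in Ioi s, q ^ (q - 1)⁻¹ * radialSlope N Φ k s * s ^ β * σ ^ (-β) :=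
        setIntegral_mono_on (h.integrableOn_radialSlope hk hs) (hint.const_mul _)
          measurableSet_Ioi fun σ hσ => h.radialSlope_le hk hs (le_of_lt hσ)
    _ = q ^ (q - 1)⁻¹ * radialSlope N Φ k s * s ^ β * (-s ^ (-β + 1) / (-β + 1)) := by
        rw [integral_const_mul, integral_Ioi_rpow_of_lt (by linarith) hs]
    _ = _ := by
        have e : s ^ (-β + 1) = s / s ^ β := by
          rw [Real.rpow_add_one hs.ne', Real.rpow_neg hs.le]; field_simp
        have h2 := Real.rpow_pos_of_pos hs β
        have h3 : β - 1 ≠ 0 := by linarith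
        have h4 : -β + 1 ≠ 0 := by linarith
        rw [e]
        field_simp
        ring

end EllipticBounds

/-! ### The Sobolev conjugate along the radial profile -/

lemma HasPowerGrowth.rpow {f : ℝ → ℝ} {α β p : ℝ} (h : HasPowerGrowth f α β) (hp : 0 < p) :
    HasPowerGrowth (fun t => f t ^ p) (α * p) (β * p) where
  exponent_pos := mul_pos h.exponent_pos hp
  pos t ht := Real.rpow_pos_of_pos (h.pos t ht) _
  lower l t hl ht := by
    have hl0 : 0 < l := one_pos.trans_le hl
    have hf := h.pos t ht
    rw [Real.rpow_mul hl0.le, ← Real.mul_rpow (Real.rpow_nonneg hl0.le _) hf.le]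
    exact Real.rpow_le_rpow (mul_nonneg (Real.rpow_nonneg hl0.le _) hf.le) (h.lower l t hl ht) hp.le
  upper l t hl ht := by
    have hl0 : 0 < l := one_pos.trans_le hl
    rw [Real.rpow_mul hl0.le, ← Real.mul_rpow (Real.rpow_nonneg hl0.le _) (h.pos t ht).le]
    exact Real.rpow_le_rpow (h.pos _ (by positivity)).le (h.upper l t hl ht) hp.le

/-- The integrand `(τ / Φ τ)^{1/(N-1)}` in the definition of the Sobolev conjugate. -/
noncomputable def sobolevIntegrand (N : ℕ) (Φ : ℝ → ℝ) (τ : ℝ) : ℝ :=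
  (τ / Φ τ) ^ (1 / ((N : ℝ) - 1))

namespace EllipticBounds

variable {N : ℕ} {Φ : ℝ → ℝ} {a b q k r : ℝ}

lemma sobolevIntegrand_pos (h : EllipticBounds N Φ a b q) {t : ℝ} (ht : 0 < t) :
    0 < sobolevIntegrand N Φ t :=
  Real.rpow_pos_of_pos (div_pos ht (h.pos t ht)) _

lemma sobolevIntegrand_mul_le (h : EllipticBounds N Φ a b q) {l t : ℝ} (hl : 1 ≤ l) (ht : 0 < t) :
    sobolevIntegrand N Φ (l * t) ≤ sobolevIntegrand N Φ t := by
  have hl0 : 0 < l := one_pos.trans_le hl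
  refine Real.rpow_le_rpow (div_pos (by positivity) (h.pos _ (by positivity))).le ?_
    (one_div_pos.2 h.dim_sub_one_pos).le
  have h1 := h.young_growth.lower l t hl ht
  rw [Real.rpow_one] at h1
  rw [div_le_div_iff₀ (h.pos _ (by positivity)) (h.pos t ht)]
  nlinarith

lemma le_sobolevIntegrand_mul (h : EllipticBounds N Φ a b q) {l t : ℝ} (hl : 1 ≤ l) (ht : 0 < t) :
    l ^ (-((q - 1) / ((N : ℝ) - 1))) * sobolevIntegrand N Φ t ≤ sobolevIntegrand N Φ (l * t) := by
  have hl0 : 0 < l := one_pos.trans_le hl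
  have e : -((q - 1) / ((N : ℝ) - 1)) = (1 - q) * (1 / ((N : ℝ) - 1)) := by ring
  have hΦ := h.pos t ht
  rw [e, Real.rpow_mul hl0.le, sobolevIntegrand, ← Real.mul_rpow (Real.rpow_nonneg hl0.le _)
    (div_pos ht hΦ).le]
  refine Real.rpow_le_rpow (by positivity) ?_ (one_div_pos.2 h.dim_sub_one_pos).le
  have h1 := h.young_growth.upper l t hl ht
  have h2 := h.pos (l * t) (by positivity)
  rw [le_div_iff₀ h2, Real.rpow_sub hl0, Real.rpow_one]
  have h3 := Real.rpow_pos_of_pos hl0 q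
  calc l / l ^ q * (t / Φ t) * Φ (l * t) ≤ l / l ^ q * (t / Φ t) * (l ^ q * Φ t) := by gcongr
    _ = l * t := by field_simp

lemma continuousOn_sobolevIntegrand (h : EllipticBounds N Φ a b q) :
    ContinuousOn (sobolevIntegrand N Φ) (Ioi 0) :=
  (continuousOn_id.div h.young_growth.continuousOn fun t ht => (h.pos t ht).ne').rpow_const
    fun t ht => Or.inl (div_pos (show 0 < t from ht) (h.pos t ht)).ne'

lemma integrableOn_sobolevIntegrand (h : EllipticBounds N Φ a b q) {t : ℝ} (ht : 0 < t) :
    IntegrableOn (sobolevIntegrand N Φ) (Ioc 0 t) := by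
  set p := (q - 1) / ((N : ℝ) - 1) with hp
  have hp1 : p < 1 := by
    rw [hp, div_lt_one h.dim_sub_one_pos]; linarith [h.lt_dim]
  have h1 : IntegrableOn (fun τ : ℝ => t ^ p * sobolevIntegrand N Φ t * τ ^ (-p)) (Ioc 0 t) :=
    ((intervalIntegral.intervalIntegrable_rpow' (by linarith)).1).const_mul _
  refine Integrable.mono' h1 ?_ ?_
  · exact (h.continuousOn_sobolevIntegrand.mono Ioc_subset_Ioi_self).aestronglyMeasurable
      measurableSet_Ioc
  · filter_upwards [ae_restrict_mem measurableSet_Ioc] with τ hτ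
    have hτ0 := hτ.1
    rw [Real.norm_of_nonneg (h.sobolevIntegrand_pos hτ0).le]
    have h2 := h.le_sobolevIntegrand_mul ((one_le_div hτ0).2 hτ.2) hτ0
    rw [div_mul_cancel₀ _ hτ0.ne', ← hp, Real.rpow_neg (div_pos ht hτ0).le,
      inv_mul_le_iff₀ (Real.rpow_pos_of_pos (div_pos ht hτ0) _), Real.div_rpow ht.le hτ0.le] at h2
    rw [Real.rpow_neg hτ0.le]
    refine h2.trans_eq (by ring)

lemma mul_sobolevIntegrand_le (h : EllipticBounds N Φ a b q) {t : ℝ} (ht : 0 < t) :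
    t * sobolevIntegrand N Φ t ≤ ∫ τ in Ioc 0 t, sobolevIntegrand N Φ τ := by
  have h1 : ∫ τ in Ioc 0 t, sobolevIntegrand N Φ t = t * sobolevIntegrand N Φ t := by
    simp [ht.le]
  rw [← h1]
  refine setIntegral_mono_on (by simp) (h.integrableOn_sobolevIntegrand ht) measurableSet_Ioc
    fun τ hτ => ?_
  have := h.sobolevIntegrand_mul_le ((one_le_div hτ.1).2 hτ.2) hτ.1
  rwa [div_mul_cancel₀ _ hτ.1.ne'] at this

lemma integral_sobolevIntegrand_growth (h : EllipticBounds N Φ a b q) :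
    HasPowerGrowth (fun t => ∫ τ in Ioc 0 t, sobolevIntegrand N Φ τ)
      (1 - (q - 1) / ((N : ℝ) - 1)) 1 := by
  have hscale : ∀ l t : ℝ, 1 ≤ l → 0 < t → ∫ τ in Ioc 0 (l * t), sobolevIntegrand N Φ τ =
      l * ∫ τ in Ioc 0 t, sobolevIntegrand N Φ (l * τ) := by
    intro l t hl ht
    rw [← intervalIntegral.integral_of_le ht.le,
      ← intervalIntegral.integral_of_le (by positivity)]
    have := intervalIntegral.smul_integral_comp_mul_left (a := 0) (b := t) (sobolevIntegrand N Φ) l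
    rw [mul_zero, smul_eq_mul] at this
    exact this.symm
  have hint : ∀ l t : ℝ, 1 ≤ l → 0 < t →
      IntegrableOn (fun τ => sobolevIntegrand N Φ (l * τ)) (Ioc 0 t) := by
    intro l t hl ht
    have hl0 : 0 < l := one_pos.trans_le hl
    refine Integrable.mono' (h.integrableOn_sobolevIntegrand ht) ?_ ?_
    · refine ContinuousOn.aestronglyMeasurable ?_ measurableSet_Ioc
      exact h.continuousOn_sobolevIntegrand.comp (by fun_prop) fun τ hτ => mul_pos hl0 hτ.1
    · filter_upwards [ae_restrict_mem measurableSet_Ioc] with τ hτ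
      rw [Real.norm_of_nonneg (h.sobolevIntegrand_pos (mul_pos hl0 hτ.1)).le]
      exact h.sobolevIntegrand_mul_le hl hτ.1
  refine ⟨?_, fun t ht => ?_, fun l t hl ht => ?_, fun l t hl ht => ?_⟩
  · rw [sub_pos, div_lt_one h.dim_sub_one_pos]; linarith [h.lt_dim]
  · exact (mul_pos ht (h.sobolevIntegrand_pos ht)).trans_le (h.mul_sobolevIntegrand_le ht)
  · have hl0 : 0 < l := one_pos.trans_le hl
    rw [hscale l t hl ht, sub_eq_add_neg, Real.rpow_add hl0, Real.rpow_one, mul_assoc,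
      ← integral_const_mul]
    refine mul_le_mul_of_nonneg_left (setIntegral_mono_on
      ((h.integrableOn_sobolevIntegrand ht).const_mul _) (hint l t hl ht) measurableSet_Ioc
      fun τ hτ => h.le_sobolevIntegrand_mul hl hτ.1) hl0.le
  · have hl0 : 0 < l := one_pos.trans_le hl
    rw [hscale l t hl ht, Real.rpow_one]
    exact mul_le_mul_of_nonneg_left (setIntegral_mono_on (hint l t hl ht)
      (h.integrableOn_sobolevIntegrand ht) measurableSet_Ioc
      fun τ hτ => h.sobolevIntegrand_mul_le hl hτ.1) hl0.le

lemma dim_pos (h : EllipticBounds N Φ a b q) : (0 : ℝ) < N := by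
  linarith [h.dim_sub_one_pos]

lemma sobolevAux_growth (h : EllipticBounds N Φ a b q) :
    HasPowerGrowth (sobolevAux N Φ)
      ((1 - (q - 1) / ((N : ℝ) - 1)) * (((N : ℝ) - 1) / N)) (1 * (((N : ℝ) - 1) / N)) :=
  h.integral_sobolevIntegrand_growth.rpow (div_pos h.dim_sub_one_pos h.dim_pos)

lemma sobolevAux_zero (h : EllipticBounds N Φ a b q) : sobolevAux N Φ 0 = 0 := by
  simp only [sobolevAux, Ioc_self, Measure.restrict_empty, integral_zero_measure]
  exact Real.zero_rpow (div_pos h.dim_sub_one_pos h.dim_pos).ne'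

/-- Since the integrand decreases, `𝓗(t) ≥ t Φ(t)^{-1/N}`. -/
lemma mul_rpow_le_sobolevAux (h : EllipticBounds N Φ a b q) {t : ℝ} (ht : 0 < t) :
    t * Φ t ^ (-(1 / (N : ℝ))) ≤ sobolevAux N Φ t := by
  have hN := h.dim_pos
  have hN1 := h.dim_sub_one_pos
  have hΦ := h.pos t ht
  have h1 : (t * sobolevIntegrand N Φ t) ^ (((N : ℝ) - 1) / N) ≤ sobolevAux N Φ t :=
    Real.rpow_le_rpow (mul_pos ht (h.sobolevIntegrand_pos ht)).le (h.mul_sobolevIntegrand_le ht)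
      (div_pos hN1 hN).le
  refine le_of_eq_of_le ?_ h1
  rw [Real.mul_rpow ht.le (h.sobolevIntegrand_pos ht).le, sobolevIntegrand,
    ← Real.rpow_mul (div_pos ht hΦ).le, Real.div_rpow ht.le hΦ.le,
    show 1 / ((N : ℝ) - 1) * (((N : ℝ) - 1) / N) = 1 / N by field_simp, ← mul_div_assoc,
    ← Real.rpow_add ht, show ((N : ℝ) - 1) / N + 1 / N = 1 by field_simp; ring, Real.rpow_one,
    Real.rpow_neg hΦ.le]
  rfl

/-- A value bounded by a multiple of `𝓗(t)` has Sobolev conjugate bounded by a multiple of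
`Φ t`. -/
lemma exists_sobolevConj_le (h : EllipticBounds N Φ a b q) (K : ℝ) :
    ∃ C, 0 < C ∧ ∀ y t, 0 < y → 0 < t → y ≤ K * sobolevAux N Φ t → sobolevConj N Φ y ≤ C * Φ t := by
  have hg := h.sobolevAux_growth
  set δ := (1 - (q - 1) / ((N : ℝ) - 1)) * (((N : ℝ) - 1) / N)
  set l := (max 1 K) ^ δ⁻¹ with hl
  have hM : 0 < max 1 K := lt_max_of_lt_left one_pos
  have hl1 : 1 ≤ l := Real.one_le_rpow (le_max_left _ _) (inv_pos.2 hg.exponent_pos).le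
  have hl0 : 0 < l := one_pos.trans_le hl1
  have hlδ : l ^ δ = max 1 K := by
    rw [hl, ← Real.rpow_mul hM.le, inv_mul_cancel₀ hg.exponent_pos.ne', Real.rpow_one]
  refine ⟨l ^ q, Real.rpow_pos_of_pos hl0 _, fun y t hy ht hyt => ?_⟩
  obtain ⟨T, hT, hTy⟩ := hg.exists_eq hy
  obtain ⟨hS0, hSy⟩ := Function.invFunOn_pos (f := sobolevAux N Φ) (s := Ici 0) (b := y)
    ⟨T, hT.le, hTy⟩
  rw [sobolevConj]
  set S := Function.invFunOn (sobolevAux N Φ) (Ici 0) y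
  have hS : 0 < S := by
    refine lt_of_le_of_ne hS0 fun e => ?_
    rw [← e, h.sobolevAux_zero] at hSy
    exact hy.ne hSy
  have h1 : S ≤ l * t := by
    rw [← hg.le_iff_le hS (by positivity), hSy]
    refine hyt.trans (le_trans ?_ (hg.lower l t hl1 ht))
    rw [hlδ]
    exact mul_le_mul_of_nonneg_right (le_max_right _ _) (hg.pos t ht).le
  exact (h.monotoneOn hS.le (mul_pos hl0 ht).le h1).trans (h.young_mul_le hl1 ht.le)

lemma young_radialSlope_le (h : EllipticBounds N Φ a b q) (hk : 0 < k) {s : ℝ} (hs : 0 < s) :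
    Φ (radialSlope N Φ k s) ≤ k * radialSlope N Φ k s * s ^ (1 - (N : ℝ)) := by
  have := h.le_mul_deriv _ (h.radialSlope_pos hk hs)
  rw [h.deriv_radialSlope hk hs] at this
  linarith

/-- The Sobolev conjugate of the profile is dominated by `Φ` of the slope. This is a radial Sobolev
inequality: the profile is at most a multiple of `s g(s)`, and `s ^ N * Φ (g s)` is bounded. -/
lemma exists_sobolevConj_radialProfile_le (h : EllipticBounds N Φ a b q) (hk : 0 < k)
    (hr : 0 < r) : ∃ C, 0 < C ∧ ∀ s, r ≤ s →
      sobolevConj N Φ (radialProfile N Φ k s) ≤ C * Φ (radialSlope N Φ k s) := by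
  obtain ⟨C₁, hC₁, hC₁s⟩ := h.exists_radialProfile_le hk
  set β := ((N : ℝ) - 1) / (q - 1) with hβ
  have hβ1 : 1 < β := h.one_lt_decay
  have hN := h.dim_pos
  set D := q ^ (q - 1)⁻¹ * radialSlope N Φ k r * r ^ β with hD
  have hD0 : 0 < D := by
    have := Real.rpow_pos_of_pos (show 0 < q by linarith [h.one_lt]) (q - 1)⁻¹
    have := h.radialSlope_pos hk hr
    positivity
  set M := k * D * r ^ (1 - β) with hM
  have hM0 : 0 < M := by positivity
  obtain ⟨C, hC, hCs⟩ := h.exists_sobolevConj_le (C₁ * M ^ (1 / (N : ℝ)))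
  refine ⟨C, hC, fun s hs => ?_⟩
  have hs0 : 0 < s := hr.trans_le hs
  have hg0 := h.radialSlope_pos hk hs0
  have hΦ0 := h.pos _ hg0
  refine hCs _ _ (h.radialProfile_pos hk hs0) hg0 ?_
  have hgs : s * radialSlope N Φ k s ≤ D * r ^ (1 - β) := by
    have h1 := h.radialSlope_le hk hr hs
    calc s * radialSlope N Φ k s ≤ s * (D * s ^ (-β)) := mul_le_mul_of_nonneg_left h1 hs0.le
      _ = D * s ^ (1 - β) := by
        rw [sub_eq_add_neg, Real.rpow_add hs0, Real.rpow_one]; ring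
      _ ≤ D * r ^ (1 - β) := by
        refine mul_le_mul_of_nonneg_left ?_ hD0.le
        exact Real.rpow_le_rpow_of_nonpos hr hs (by linarith)
  have hsN : s ^ (N : ℝ) * Φ (radialSlope N Φ k s) ≤ M := by
    have h1 := h.young_radialSlope_le hk hs0
    calc s ^ (N : ℝ) * Φ (radialSlope N Φ k s)
        ≤ s ^ (N : ℝ) * (k * radialSlope N Φ k s * s ^ (1 - (N : ℝ))) := by gcongr
      _ = k * (s * radialSlope N Φ k s) := by
        rw [Real.rpow_sub hs0, Real.rpow_one]
        field_simp
      _ ≤ k * (D * r ^ (1 - β)) := by gcongr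
      _ = M := by rw [hM]; ring
  have hs1 : s ≤ M ^ (1 / (N : ℝ)) * Φ (radialSlope N Φ k s) ^ (-(1 / (N : ℝ))) := by
    rw [Real.rpow_neg hΦ0.le, ← div_eq_mul_inv, ← Real.div_rpow hM0.le hΦ0.le]
    have h1 : s ^ (N : ℝ) ≤ M / Φ (radialSlope N Φ k s) := (le_div_iff₀ hΦ0).2 hsN
    have h2 := Real.rpow_le_rpow (by positivity) h1 (show 0 ≤ 1 / (N : ℝ) by positivity)
    rwa [← Real.rpow_mul hs0.le, mul_one_div_cancel hN.ne', Real.rpow_one] at h2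
  calc radialProfile N Φ k s ≤ C₁ * (s * radialSlope N Φ k s) := hC₁s s hs0
    _ ≤ C₁ * (M ^ (1 / (N : ℝ)) * Φ (radialSlope N Φ k s) ^ (-(1 / (N : ℝ)))
          * radialSlope N Φ k s) := by gcongr
    _ = C₁ * M ^ (1 / (N : ℝ)) *
          (radialSlope N Φ k s * Φ (radialSlope N Φ k s) ^ (-(1 / (N : ℝ)))) := by ring
    _ ≤ _ := mul_le_mul_of_nonneg_left (h.mul_rpow_le_sobolevAux hg0) (by positivity)

/-- The modular of the gradient of the radial solution is finite outside every ball. -/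
lemma integrableOn_young_radialSlope (h : EllipticBounds N Φ a b q) (hk : 0 < k) (hr : 0 < r) :
    IntegrableOn (fun x : EuclideanSpace ℝ (Fin N) => Φ (radialSlope N Φ k ‖x‖))
      (Metric.closedBall 0 r)ᶜ := by
  set β := ((N : ℝ) - 1) / (q - 1) with hβ
  have hβ1 : 1 < β := h.one_lt_decay
  have hN1 := h.dim_sub_one_pos
  set D := q ^ (q - 1)⁻¹ * radialSlope N Φ k r * r ^ β with hD
  have hD0 : 0 < D := by
    have := Real.rpow_pos_of_pos (show 0 < q by linarith [h.one_lt]) (q - 1)⁻¹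
    have := h.radialSlope_pos hk hr
    positivity
  set e := β + N - 1 with he
  have he0 : 0 < e := by linarith
  -- For `s ≥ r` the powers of `s` and of `1 + s` are comparable.
  set c := (1 + 1 / r) with hc
  have hc0 : 0 < c := by positivity
  have hmeas : MeasurableSet (Metric.closedBall (0 : EuclideanSpace ℝ (Fin N)) r)ᶜ :=
    Metric.isClosed_closedBall.measurableSet.compl
  have hint : Integrable (fun x : EuclideanSpace ℝ (Fin N) =>
      k * D * c ^ e * (1 + ‖x‖) ^ (-e)) := by
    refine (integrable_one_add_norm ?_).const_mul _
    simp only [finrank_euclideanSpace, Fintype.card_fin]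
    linarith
  refine Integrable.mono' hint.integrableOn ?_ ?_
  · refine ContinuousOn.aestronglyMeasurable ?_ hmeas
    refine h.young_growth.continuousOn.comp (t := Ioi 0)
      ((h.continuousOn_radialSlope hk).comp continuous_norm.continuousOn ?_) ?_
    · intro x hx
      have : r < ‖x‖ := by simpa using hx
      exact hr.trans this
    · intro x hx
      have : r < ‖x‖ := by simpa using hx
      exact h.radialSlope_pos hk (hr.trans this)
  · filter_upwards [ae_restrict_mem hmeas] with x hx
    have hxr : r < ‖x‖ := by simpa using hx
    set s := ‖x‖
    have hs0 : 0 < s := hr.trans hxr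
    rw [Real.norm_of_nonneg (h.pos _ (h.radialSlope_pos hk hs0)).le]
    have h1 : 1 + s ≤ c * s := by
      have : 1 ≤ s / r := (one_le_div hr).2 hxr.le
      calc 1 + s ≤ s / r + s := by linarith
        _ = c * s := by rw [hc]; ring
    have h2 : s ^ (-e) ≤ c ^ e * (1 + s) ^ (-e) := by
      rw [Real.rpow_neg hs0.le, Real.rpow_neg (by positivity), ← div_eq_mul_inv,
        ← Real.div_rpow hc0.le (by positivity), ← Real.inv_rpow hs0.le]
      refine Real.rpow_le_rpow (by positivity) ?_ he0.le
      rw [inv_le_iff_one_le_mul₀ hs0, ← mul_div_right_comm, one_le_div (by positivity)]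
      exact h1
    calc Φ (radialSlope N Φ k s) ≤ k * radialSlope N Φ k s * s ^ (1 - (N : ℝ)) :=
          h.young_radialSlope_le hk hs0
      _ ≤ k * (D * s ^ (-β)) * s ^ (1 - (N : ℝ)) := by
          gcongr
          exact h.radialSlope_le hk hr hxr.le
      _ = k * D * s ^ (-e) := by
          rw [show -e = -β + (1 - (N : ℝ)) by rw [he]; ring, Real.rpow_add hs0]; ring
      _ ≤ k * D * (c ^ e * (1 + s) ^ (-e)) := by gcongr
      _ = _ := by ring

end EllipticBounds

/-! ### Radial functions, weak gradients and divergence-free fields -/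

lemma hasDerivAt_integral_Ioi {f : ℝ → ℝ} {c s : ℝ} (hf : ContinuousOn f (Ioi c))
    (hint : IntegrableOn f (Ioi c)) (hs : c < s) :
    HasDerivAt (fun t => ∫ σ in Ioi t, f σ) (-f s) s := by
  have h1 : HasDerivAt (fun t => ∫ σ in c..t, f σ) (f s) s := by
    refine intervalIntegral.integral_hasDerivAt_right ?_
      (hf.stronglyMeasurableAtFilter isOpen_Ioi s hs) (hf.continuousAt (Ioi_mem_nhds hs))
    rw [intervalIntegrable_iff_integrableOn_Ioc_of_le hs.le]
    exact hint.mono_set Ioc_subset_Ioi_self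
  refine (h1.const_sub (∫ σ in Ioi c, f σ)).congr_of_eventuallyEq ?_
  filter_upwards [Ioi_mem_nhds hs] with t ht
  rw [← intervalIntegral.integral_interval_add_Ioi hint
    (hint.mono_set (Ioi_subset_Ioi (le_of_lt ht)))]
  ring

section Radial

variable {E : Type*} [NormedAddCommGroup E] [InnerProductSpace ℝ E]

lemma hasFDerivAt_norm_of_ne_zero {x : E} (hx : x ≠ 0) :
    HasFDerivAt (fun y : E => ‖y‖) (‖x‖⁻¹ • innerSL ℝ x) x := by
  have h1 := (hasStrictFDerivAt_norm_sq x).hasFDerivAt.sqrt (by simpa using hx)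
  simp only [Real.sqrt_sq (norm_nonneg _)] at h1
  convert h1 using 1
  ext v
  simp
  field_simp

variable [CompleteSpace E]

lemma HasDerivAt.hasGradientAt_comp_norm {f : ℝ → ℝ} {f' : ℝ} {x : E} (hx : x ≠ 0)
    (hf : HasDerivAt f f' ‖x‖) : HasGradientAt (fun y : E => f ‖y‖) ((f' / ‖x‖) • x) x := by
  have h1 := hf.comp_hasFDerivAt x (hasFDerivAt_norm_of_ne_zero hx)
  have e : InnerProductSpace.toDual ℝ E ((f' / ‖x‖) • x) = f' • ‖x‖⁻¹ • innerSL ℝ x := by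
    ext v
    simp [div_eq_mul_inv, mul_assoc]
  rw [hasGradientAt_iff_hasFDerivAt, e]
  exact h1

end Radial

section Euclidean

variable {N : ℕ}

lemma integrable_of_continuousOn_of_eq_zero {X F : Type*} [TopologicalSpace X] [T2Space X]
    [MeasurableSpace X] [BorelSpace X] [NormedAddCommGroup F] {μ : Measure X}
    [IsFiniteMeasureOnCompacts μ] [TopologicalSpace.PseudoMetrizableSpace X] {f : X → F} {K : Set X}
    (hK : IsCompact K) (hf : ContinuousOn f K) (h0 : ∀ x, x ∉ K → f x = 0) : Integrable f μ := by
  have h1 : IntegrableOn f K μ := hf.integrableOn_compact' hK hK.measurableSet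
  exact (integrableOn_iff_integrable_of_support_subset
    (Function.support_subset_iff'.2 h0)).1 h1

variable {Ω : Set (EuclideanSpace ℝ (Fin N))} {ξ : EuclideanSpace ℝ (Fin N) → ℝ}

lemma IsTestFunction.continuous_gradient (h : IsTestFunction Ω ξ) : Continuous (∇ ξ) :=
  (InnerProductSpace.toDual ℝ _).symm.continuous.comp (h.1.continuous_fderiv (by simp))

lemma gradient_eq_zero_of_notMem_tsupport {x : EuclideanSpace ℝ (Fin N)} (hx : x ∉ tsupport ξ) :
    ∇ ξ x = 0 := by
  have : fderiv ℝ ξ x = 0 :=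
    image_eq_zero_of_notMem_tsupport (f := fderiv ℝ ξ) fun h => hx (tsupport_fderiv_subset ℝ h)
  simp [gradient, this]

lemma inner_gradient {x v : EuclideanSpace ℝ (Fin N)} : ⟪∇ ξ x, v⟫ = fderiv ℝ ξ x v := by
  simp [gradient]

/-- Integration by parts against a test function, for a function that is differentiable only
in `Ω`. -/
lemma IsTestFunction.integral_mul_fderiv (h : IsTestFunction Ω ξ)
    {u : EuclideanSpace ℝ (Fin N) → ℝ}
    {u' : EuclideanSpace ℝ (Fin N) → EuclideanSpace ℝ (Fin N) →L[ℝ] ℝ}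
    {v : EuclideanSpace ℝ (Fin N)} (hu : ∀ x ∈ Ω, HasFDerivAt u (u' x) x)
    (hu' : ContinuousOn (fun x => u' x v) Ω) :
    ∫ x, u x * fderiv ℝ ξ x v = -∫ x, u' x v * ξ x := by
  have hc : ContinuousOn u (tsupport ξ) := fun x hx =>
    (hu x (h.2.2 hx)).continuousAt.continuousWithinAt
  have hξ : Continuous ξ := h.1.continuous
  have hdξ : Continuous (fun x => fderiv ℝ ξ x v) :=
    (h.1.continuous_fderiv (by simp)).clm_apply continuous_const
  refine integral_bilinear_hasFDerivAt_right_eq_neg_left_of_integrable (f := u) (f' := u')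
    (g := ξ) (g' := fderiv ℝ ξ) (v := v) (B := ContinuousLinearMap.mul ℝ ℝ) ?_ ?_ ?_
    (fun x hx => hu x (h.2.2 hx))
    (fun x _ => (h.1.differentiable (by simp) x).hasFDerivAt)
  · refine integrable_of_continuousOn_of_eq_zero h.2.1
      ((hu'.mono h.2.2).mul hξ.continuousOn) fun x hx => ?_
    simp [image_eq_zero_of_notMem_tsupport hx]
  · refine integrable_of_continuousOn_of_eq_zero h.2.1 (hc.mul hdξ.continuousOn) fun x hx => ?_
    simp [← inner_gradient, gradient_eq_zero_of_notMem_tsupport hx]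
  · refine integrable_of_continuousOn_of_eq_zero h.2.1 (hc.mul hξ.continuousOn) fun x hx => ?_
    simp [image_eq_zero_of_notMem_tsupport hx]

lemma IsTestFunction.setIntegral_eq {F : Type*} [NormedAddCommGroup F] [NormedSpace ℝ F]
    (h : IsTestFunction Ω ξ) {f : EuclideanSpace ℝ (Fin N) → F}
    (hf : ∀ x, x ∉ tsupport ξ → f x = 0) : ∫ x in Ω, f x = ∫ x, f x :=
  setIntegral_eq_integral_of_forall_compl_eq_zero fun x hx => hf x fun hx' => hx (h.2.2 hx')

/-- A continuous classical gradient is a weak gradient. -/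
lemma isWeakGradientOn_of_hasGradientAt (hΩ : IsOpen Ω) {u : EuclideanSpace ℝ (Fin N) → ℝ}
    {G : EuclideanSpace ℝ (Fin N) → EuclideanSpace ℝ (Fin N)}
    (hu : ∀ x ∈ Ω, HasGradientAt u (G x) x) (hG : ContinuousOn G Ω) : IsWeakGradientOn Ω u G := by
  have huc : ContinuousOn u Ω := fun x hx => (hu x hx).continuousAt.continuousWithinAt
  refine ⟨huc.locallyIntegrableOn hΩ.measurableSet, hG.locallyIntegrableOn hΩ.measurableSet,
    fun ξ hξ => ?_⟩
  rw [hξ.setIntegral_eq fun x hx => by simp [gradient_eq_zero_of_notMem_tsupport hx],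
    hξ.setIntegral_eq fun x hx => by simp [image_eq_zero_of_notMem_tsupport hx]]
  have hi1 : Integrable (fun x => u x • ∇ ξ x) :=
    integrable_of_continuousOn_of_eq_zero hξ.2.1
      ((huc.mono hξ.2.2).smul hξ.continuous_gradient.continuousOn)
      fun x hx => by simp [gradient_eq_zero_of_notMem_tsupport hx]
  have hi2 : Integrable (fun x => ξ x • G x) :=
    integrable_of_continuousOn_of_eq_zero hξ.2.1
      (hξ.1.continuous.continuousOn.smul (hG.mono hξ.2.2))
      fun x hx => by simp [image_eq_zero_of_notMem_tsupport hx]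
  refine ext_inner_left ℝ fun v => ?_
  rw [inner_neg_right, ← integral_inner hi1, ← integral_inner hi2]
  have h1 := hξ.integral_mul_fderiv (u := u)
    (u' := fun x => InnerProductSpace.toDual ℝ (EuclideanSpace ℝ (Fin N)) (G x)) (v := v)
    (fun x hx => (hu x hx).hasFDerivAt)
    (by simpa using hG.inner continuousOn_const)
  simp only [InnerProductSpace.toDual_apply_apply, ← inner_gradient] at h1
  simp only [inner_smul_right]
  rw [show (fun x => u x * ⟪v, ∇ ξ x⟫) = fun x => u x * ⟪∇ ξ x, v⟫ by
      funext x; rw [real_inner_comm],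
    show (fun x => ξ x * ⟪v, G x⟫) = fun x => ⟪G x, v⟫ * ξ x by
      funext x; rw [real_inner_comm, mul_comm]]
  exact h1

/-- The field `x / |x|^N` is divergence free away from the origin, in the weak sense. -/
lemma IsTestFunction.integral_inner_norm_rpow_smul (h : IsTestFunction {0}ᶜ ξ) :
    ∫ x, ⟪(‖x‖ ^ (-(N : ℝ))) • x, ∇ ξ x⟫ = 0 := by
  set e : Fin N → EuclideanSpace ℝ (Fin N) := fun i => EuclideanSpace.single i 1 with he
  set u : Fin N → EuclideanSpace ℝ (Fin N) → ℝ := fun i x => ‖x‖ ^ (-(N : ℝ)) * x i with hu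
  -- the derivative of the `i`-th component in the `i`-th direction
  set d : Fin N → EuclideanSpace ℝ (Fin N) → ℝ := fun i x =>
    ‖x‖ ^ (-(N : ℝ)) + -(N : ℝ) * ‖x‖ ^ (-(N : ℝ) - 1) * ‖x‖⁻¹ * x i * x i with hd
  set u' : Fin N → EuclideanSpace ℝ (Fin N) → EuclideanSpace ℝ (Fin N) →L[ℝ] ℝ := fun i x =>
    ‖x‖ ^ (-(N : ℝ)) • (EuclideanSpace.proj i : EuclideanSpace ℝ (Fin N) →L[ℝ] ℝ) +
      x i • ((-(N : ℝ) * ‖x‖ ^ (-(N : ℝ) - 1)) • (‖x‖⁻¹ • innerSL ℝ x)) with hu'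
  have hder : ∀ i, ∀ x ∈ ({0}ᶜ : Set (EuclideanSpace ℝ (Fin N))),
      HasFDerivAt (u i) (u' i x) x := by
    intro i x hx
    have hx0 : x ≠ 0 := hx
    exact ((Real.hasDerivAt_rpow_const (p := -(N : ℝ))
      (Or.inl (norm_ne_zero_iff.2 hx0))).comp_hasFDerivAt x (hasFDerivAt_norm_of_ne_zero hx0)).mul
      (EuclideanSpace.proj i : EuclideanSpace ℝ (Fin N) →L[ℝ] ℝ).hasFDerivAt
  have hu'd : ∀ i x, u' i x (e i) = d i x := by
    intro i x
    simp [hu', hd, he, EuclideanSpace.inner_single_right]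
    ring
  have hcn : ∀ p : ℝ, ContinuousOn (fun x : EuclideanSpace ℝ (Fin N) => ‖x‖ ^ p) {0}ᶜ := fun p =>
    continuous_norm.continuousOn.rpow_const fun x hx => Or.inl (norm_ne_zero_iff.2 hx)
  have hinv : ContinuousOn (fun x : EuclideanSpace ℝ (Fin N) => ‖x‖⁻¹) {0}ᶜ :=
    continuous_norm.continuousOn.inv₀ fun x hx => norm_ne_zero_iff.2 hx
  have hco : ∀ i, ContinuousOn (fun x : EuclideanSpace ℝ (Fin N) => x i) {0}ᶜ := fun i =>
    (EuclideanSpace.proj i : EuclideanSpace ℝ (Fin N) →L[ℝ] ℝ).continuous.continuousOn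
  have hdc : ∀ i, ContinuousOn (d i) {0}ᶜ := fun i =>
    (hcn _).add ((((continuousOn_const.mul (hcn _)).mul hinv).mul (hco i)).mul (hco i))
  have hparts : ∀ i, ∫ x, u i x * fderiv ℝ ξ x (e i) = -∫ x, d i x * ξ x := by
    intro i
    have := h.integral_mul_fderiv (u := u i) (u' := u' i) (v := e i) (hder i)
      (by simpa only [hu'd] using hdc i)
    simpa only [hu'd] using this
  have hsum : ∀ x, ⟪(‖x‖ ^ (-(N : ℝ))) • x, ∇ ξ x⟫ = ∑ i, u i x * fderiv ℝ ξ x (e i) := by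
    intro x
    rw [PiLp.inner_apply]
    refine Finset.sum_congr rfl fun i _ => ?_
    rw [← inner_gradient, EuclideanSpace.inner_single_right]
    simp [hu]
    ring
  have hdiv : ∀ x, x ∈ tsupport ξ → ∑ i, d i x = 0 := by
    intro x hx
    have hx0 : 0 < ‖x‖ := norm_pos_iff.2 (h.2.2 hx)
    have hn : ∑ i, x i * x i = ‖x‖ ^ 2 := by
      rw [EuclideanSpace.real_norm_sq_eq]
      exact Finset.sum_congr rfl fun i _ => (sq _).symm
    simp only [hd, mul_assoc]
    rw [Finset.sum_add_distrib, ← Finset.mul_sum, ← Finset.mul_sum, ← Finset.mul_sum, hn,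
      Real.rpow_sub_one hx0.ne']
    simp
    field_simp
    ring
  calc ∫ x, ⟪(‖x‖ ^ (-(N : ℝ))) • x, ∇ ξ x⟫
      = ∑ i, ∫ x, u i x * fderiv ℝ ξ x (e i) := by
        simp_rw [hsum]
        refine integral_finsetSum _ fun i _ => ?_
        refine integrable_of_continuousOn_of_eq_zero h.2.1
          ((((hcn _).mul (hco i)).mono h.2.2).mul
            ((h.1.continuous_fderiv (by simp)).clm_apply continuous_const).continuousOn)
          fun x hx => ?_
        simp [← inner_gradient, gradient_eq_zero_of_notMem_tsupport hx]
    _ = -∑ i, ∫ x, d i x * ξ x := by simp_rw [hparts, Finset.sum_neg_distrib]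
    _ = -∫ x, ∑ i, d i x * ξ x := by
        rw [integral_finsetSum _ fun i _ => ?_]
        exact integrable_of_continuousOn_of_eq_zero h.2.1
          (((hdc i).mono h.2.2).mul h.1.continuous.continuousOn)
          fun x hx => by simp [image_eq_zero_of_notMem_tsupport hx]
    _ = 0 := by
        rw [neg_eq_zero]
        refine integral_eq_zero_of_ae (Eventually.of_forall fun x => ?_)
        by_cases hx : x ∈ tsupport ξ
        · simp [← Finset.sum_mul, hdiv x hx]
        · simp [image_eq_zero_of_notMem_tsupport hx]

end Euclidean

/-! ### The radial solution -/

/-- The gradient of the radial solution `x ↦ ∫_{|x|}^∞ φ⁻¹(k s^{1-N}) ds`. -/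
noncomputable def radialGradient (N : ℕ) (Φ : ℝ → ℝ) (k : ℝ) (x : EuclideanSpace ℝ (Fin N)) :
    EuclideanSpace ℝ (Fin N) :=
  (-radialSlope N Φ k ‖x‖ / ‖x‖) • x

namespace EllipticBounds

variable {N : ℕ} {Φ : ℝ → ℝ} {a b q k r : ℝ}

lemma hasDerivAt_radialProfile (h : EllipticBounds N Φ a b q) (hk : 0 < k) {s : ℝ} (hs : 0 < s) :
    HasDerivAt (radialProfile N Φ k) (-radialSlope N Φ k s) s :=
  hasDerivAt_integral_Ioi
    ((h.continuousOn_radialSlope hk).mono (Ioi_subset_Ioi (half_pos hs).le))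
    (h.integrableOn_radialSlope hk (half_pos hs)) (half_lt_self hs)

lemma hasGradientAt_radialProfile (h : EllipticBounds N Φ a b q) (hk : 0 < k)
    {x : EuclideanSpace ℝ (Fin N)} (hx : x ≠ 0) :
    HasGradientAt (fun y => radialProfile N Φ k ‖y‖) (radialGradient N Φ k x) x :=
  (h.hasDerivAt_radialProfile hk (norm_pos_iff.2 hx)).hasGradientAt_comp_norm hx

lemma continuousOn_radialGradient (h : EllipticBounds N Φ a b q) (hk : 0 < k) :
    ContinuousOn (radialGradient N Φ k) {0}ᶜ :=
  (((h.continuousOn_radialSlope hk).comp continuous_norm.continuousOn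
    fun _ hx => norm_pos_iff.2 hx).neg.div continuous_norm.continuousOn
    fun _ hx => norm_ne_zero_iff.2 hx).smul continuousOn_id

lemma norm_radialGradient (h : EllipticBounds N Φ a b q) (hk : 0 < k)
    {x : EuclideanSpace ℝ (Fin N)} (hx : x ≠ 0) :
    ‖radialGradient N Φ k x‖ = radialSlope N Φ k ‖x‖ := by
  have hx0 := norm_pos_iff.2 hx
  rw [radialGradient, norm_smul, norm_div, norm_neg, norm_norm, div_mul_cancel₀ _ hx0.ne',
    Real.norm_of_nonneg (h.radialSlope_pos hk hx0).le]

/-- The slope is chosen so that the flux is a multiple of `x / |x|^N`. -/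
lemma phiFlux_radialGradient (h : EllipticBounds N Φ a b q) (hk : 0 < k)
    {x : EuclideanSpace ℝ (Fin N)} (hx : x ≠ 0) :
    phiFlux Φ (radialGradient N Φ k x) = (-k) • (‖x‖ ^ (-(N : ℝ))) • x := by
  have hx0 := norm_pos_iff.2 hx
  have hg := h.radialSlope_pos hk hx0
  rw [phiFlux, h.norm_radialGradient hk hx, h.deriv_radialSlope hk hx0, radialGradient, smul_smul,
    smul_smul, sub_eq_add_neg, Real.rpow_add hx0, Real.rpow_one]
  congr 1
  field_simp

lemma contDiffOn_radialProfile (h : EllipticBounds N Φ a b q) (hk : 0 < k) :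
    ContDiffOn ℝ 1 (fun x : EuclideanSpace ℝ (Fin N) => radialProfile N Φ k ‖x‖) {0}ᶜ := by
  have h1 : ContDiffOn ℝ 1 (radialProfile N Φ k) (Ioi 0) := by
    rw [show (1 : WithTop ℕ∞) = 0 + 1 by simp, contDiffOn_succ_iff_deriv_of_isOpen isOpen_Ioi]
    refine ⟨fun s hs => (h.hasDerivAt_radialProfile hk hs).differentiableAt.differentiableWithinAt,
      by simp, ?_⟩
    rw [contDiffOn_zero]
    exact (h.continuousOn_radialSlope hk).neg.congr fun s hs =>
      (h.hasDerivAt_radialProfile hk hs).deriv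
  exact h1.comp (fun x hx => (contDiffAt_norm ℝ hx).contDiffWithinAt)
    fun x hx => norm_pos_iff.2 hx

lemma isPhiHarmonicOn_radialProfile (h : EllipticBounds N Φ a b q) (hk : 0 < k) :
    IsPhiHarmonicOn Φ {0}ᶜ (fun x : EuclideanSpace ℝ (Fin N) => radialProfile N Φ k ‖x‖) := by
  refine ⟨radialGradient N Φ k, isWeakGradientOn_of_hasGradientAt isOpen_compl_singleton
    (fun x hx => h.hasGradientAt_radialProfile hk hx) (h.continuousOn_radialGradient hk), ?_,
    fun ξ hξ => ?_⟩
  · refine ContinuousOn.locallyIntegrableOn ?_ isOpen_compl_singleton.measurableSet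
    refine ContinuousOn.congr
      (f := fun x : EuclideanSpace ℝ (Fin N) => (-k) • (‖x‖ ^ (-(N : ℝ))) • x) ?_
      fun x hx => h.phiFlux_radialGradient hk hx
    have hc : ContinuousOn (fun x : EuclideanSpace ℝ (Fin N) => ‖x‖ ^ (-(N : ℝ))) {0}ᶜ :=
      continuous_norm.continuousOn.rpow_const fun x hx => Or.inl (norm_ne_zero_iff.2 hx)
    exact (hc.smul continuousOn_id).const_smul (-k)
  · rw [setIntegral_congr_fun isOpen_compl_singleton.measurableSet
      (g := fun x => (-k) * ⟪(‖x‖ ^ (-(N : ℝ))) • x, ∇ ξ x⟫)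
      (fun x hx => by simp only [h.phiFlux_radialGradient hk hx]; rw [real_inner_smul_left]),
      hξ.setIntegral_eq (fun x hx => by simp [gradient_eq_zero_of_notMem_tsupport hx]),
      integral_const_mul, hξ.integral_inner_norm_rpow_smul, mul_zero]

end EllipticBounds

/-! ### Smooth approximation of the radial solution -/

/-- The primitive of a smooth slope supported in a compact interval of `(0,∞)` gives a radial test
function: it is constant near the origin and vanishes for large `|x|`. -/
lemma isTestFunction_integral_Ioi_norm {N : ℕ} {f : ℝ → ℝ} {ρ R : ℝ} (hf : ContDiff ℝ ∞ f)
    (hρ : 0 < ρ) (hsupp : Function.support f ⊆ Ioo ρ R) :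
    IsTestFunction univ (fun x : EuclideanSpace ℝ (Fin N) => ∫ σ in Ioi ‖x‖, f σ) ∧
      ∀ x : EuclideanSpace ℝ (Fin N), x ≠ 0 →
        ∇ (fun x : EuclideanSpace ℝ (Fin N) => ∫ σ in Ioi ‖x‖, f σ) x = (-f ‖x‖ / ‖x‖) • x := by
  have hcs : HasCompactSupport f := HasCompactSupport.of_support_subset_isCompact isCompact_Icc
    (hsupp.trans Ioo_subset_Icc_self)
  have hint : Integrable f := hf.continuous.integrable_of_hasCompactSupport hcs
  have hder : ∀ s, HasDerivAt (fun t => ∫ σ in Ioi t, f σ) (-f s) s := fun s =>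
    hasDerivAt_integral_Ioi (c := s - 1) hf.continuous.continuousOn hint.integrableOn (by simp)
  have hW : ContDiff ℝ ∞ (fun t => ∫ σ in Ioi t, f σ) := by
    rw [contDiff_infty_iff_deriv]
    refine ⟨fun s => (hder s).differentiableAt, ?_⟩
    rw [show deriv (fun t => ∫ σ in Ioi t, f σ) = fun s => -f s from
      funext fun s => (hder s).deriv]
    exact hf.neg
  have hconst : ∀ s, s ≤ ρ → ∫ σ in Ioi s, f σ = ∫ σ in Ioi ρ, f σ := by
    intro s hs
    rw [← intervalIntegral.integral_interval_add_Ioi (a := s) (b := ρ) hint.integrableOn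
      hint.integrableOn, intervalIntegral.integral_of_le hs]
    rw [setIntegral_eq_zero_of_forall_eq_zero, zero_add]
    intro σ hσ
    by_contra hne
    exact absurd (hsupp hne).1 (not_lt.2 hσ.2)
  refine ⟨⟨?_, ?_, subset_univ _⟩, fun x hx => ((hder _).hasGradientAt_comp_norm hx).gradient⟩
  · rw [contDiff_iff_contDiffAt]
    intro x
    by_cases hx : x = 0
    · subst hx
      refine (contDiffAt_const (c := ∫ σ in Ioi ρ, f σ)).congr_of_eventuallyEq ?_
      filter_upwards [Metric.closedBall_mem_nhds (0 : EuclideanSpace ℝ (Fin N)) hρ] with y hy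
      exact hconst _ (by simpa using hy)
    · exact hW.contDiffAt.comp x (contDiffAt_norm ℝ hx)
  · refine HasCompactSupport.intro (isCompact_closedBall (0 : EuclideanSpace ℝ (Fin N)) R)
      fun x hx => ?_
    have hx' : R < ‖x‖ := by simpa using hx
    refine setIntegral_eq_zero_of_forall_eq_zero fun σ hσ => ?_
    by_contra hne
    exact absurd (hsupp hne).2 (not_lt.2 (hx'.trans hσ).le)

/-- A continuous positive function on `(0,∞)` is approximated on `[r,∞)` by smooth functions with
compact support in `(0,∞)`. The error is at most twice the function, which serves as a dominating
bound, and on `[r, r + n]` it is at most the fraction `1 / (n + 1)` of the function. -/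
lemma exists_contDiff_support_subset_approx {g : ℝ → ℝ} {r : ℝ} (hr : 0 < r)
    (hg : ContinuousOn g (Ioi 0)) (hpos : ∀ s, 0 < s → 0 < g s) (n : ℕ) :
    ∃ f : ℝ → ℝ, ContDiff ℝ ∞ f ∧ Function.support f ⊆ Ioo (r / 2) (r + n + 1) ∧
      (∀ s, r ≤ s → |f s - g s| ≤ 2 * g s) ∧
      ∀ s, r ≤ s → s ≤ r + n → |f s - g s| ≤ g s / (n + 1) := by
  set G : ℝ → ℝ := fun s => g (max s (r / 2)) with hG
  have hmax : ∀ s, 0 < max s (r / 2) := fun s => lt_max_of_lt_right (half_pos hr)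
  have hGc : Continuous G := hg.comp_continuous (by fun_prop) hmax
  have hGg : ∀ s, r ≤ s → G s = g s := fun s hs => by
    simp only [hG]; rw [max_eq_left (by linarith)]
  -- a continuous cutoff, equal to `1` on `[r, r + n]`
  set θ : ℝ → ℝ := fun s => max 0 (min 1 (min (2 / r * s - 1) (r + n + 1 - s))) with hθ
  have hθc : Continuous θ := by fun_prop
  have hθ0 : ∀ s, 0 ≤ θ s := fun s => le_max_left _ _
  have hθ1 : ∀ s, θ s ≤ 1 := fun s => max_le zero_le_one (min_le_left _ _)
  have hθeq : ∀ s, r ≤ s → s ≤ r + n → θ s = 1 := by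
    intro s hs hsn
    have h1 : 1 ≤ 2 / r * s - 1 := by
      have : 2 ≤ 2 / r * s := by
        rw [div_mul_eq_mul_div, le_div_iff₀ hr]; linarith
      linarith
    simp only [hθ]
    rw [min_eq_left (le_min h1 (by linarith)), max_eq_right zero_le_one]
  have hθs : Function.support θ ⊆ Ioo (r / 2) (r + n + 1) := by
    intro s hs
    have h1 : 0 < min 1 (min (2 / r * s - 1) (r + n + 1 - s)) := by
      by_contra hne
      exact hs (max_eq_left (not_lt.1 hne))
    have h2 := (lt_min_iff.1 h1).2
    have h3 := (lt_min_iff.1 h2).1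
    have h4 := (lt_min_iff.1 h2).2
    refine ⟨?_, by linarith⟩
    have h5 : 1 < 2 / r * s := by linarith
    rw [div_mul_eq_mul_div, one_lt_div hr] at h5
    linarith
  have hn : (0 : ℝ) < n + 1 := by positivity
  obtain ⟨f, hf, hfd, hfs⟩ := (hGc.mul hθc).exists_contDiff_approx ⊤ (ε := fun s => G s / (n + 1))
    (hGc.div_const _) (fun s => div_pos (hpos _ (hmax s)) hn)
  refine ⟨f, hf, hfs.trans ((Function.support_mul_subset_right _ _).trans hθs), fun s hs => ?_,
    fun s hs hsn => ?_⟩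
  · have h1 : |f s - G s * θ s| < G s / (n + 1) := hfd s
    rw [hGg s hs] at h1
    have h0 := hpos s (hr.trans_le hs)
    have h2 : g s / (n + 1) ≤ g s := div_le_self h0.le (by simp)
    have h3 := hθ0 s
    have h4 := hθ1 s
    rw [abs_lt] at h1
    rw [abs_le]
    constructor <;> nlinarith
  · have h1 : |f s - G s * θ s| < G s / (n + 1) := hfd s
    rw [hGg s hs, hθeq s hs hsn, mul_one] at h1
    exact h1.le

lemma tendsto_luxemburgNorm_zero {X F : Type*} [MeasurableSpace X] [NormedAddCommGroup F]
    {Λ : ℝ → ℝ} {μ : Measure X} {f : ℕ → X → F}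
    (h : ∀ τ : ℝ, 0 < τ →
      Tendsto (fun n => ∫⁻ x, ENNReal.ofReal (Λ (‖f n x‖ / τ)) ∂μ) atTop (𝓝 0)) :
    Tendsto (fun n => luxemburgNorm Λ μ (f n)) atTop (𝓝 0) := by
  rw [ENNReal.tendsto_nhds_zero]
  intro ε hε
  obtain ⟨τ, hτ0, hτ, hτε⟩ := ENNReal.lt_iff_exists_real_btwn.1 hε
  have hτ' : 0 < τ := ENNReal.ofReal_pos.1 hτ
  filter_upwards [(ENNReal.tendsto_nhds_zero.1 (h τ hτ')) 1 one_pos] with n hn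
  exact (iInf₂_le τ ⟨hτ', hn⟩).trans hτε.le

namespace EllipticBounds

variable {N : ℕ} {Φ : ℝ → ℝ} {a b q k r : ℝ}

lemma memBeppoLevi_radialProfile (h : EllipticBounds N Φ a b q) (hk : 0 < k) (hr : 0 < r) :
    MemBeppoLevi Φ (Metric.closedBall 0 r)ᶜ
      (fun x : EuclideanSpace ℝ (Fin N) => radialProfile N Φ k ‖x‖) := by
  set Ω : Set (EuclideanSpace ℝ (Fin N)) := (Metric.closedBall 0 r)ᶜ with hΩ
  have hΩo : IsOpen Ω := Metric.isClosed_closedBall.isOpen_compl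
  have hΩm : MeasurableSet Ω := hΩo.measurableSet
  have hΩr : ∀ x ∈ Ω, r < ‖x‖ := fun x hx => by simpa [hΩ] using hx
  have hΩpos : ∀ x ∈ Ω, 0 < ‖x‖ := fun x hx => hr.trans (hΩr x hx)
  have hΩ0 : Ω ⊆ {0}ᶜ := fun x hx => norm_pos_iff.1 (hΩpos x hx)
  have hint := h.integrableOn_young_radialSlope hk hr
  have hfin : ∀ C : ℝ,
      ∫⁻ x in Ω, ENNReal.ofReal (C * Φ (radialSlope N Φ k ‖x‖)) < ⊤ := fun C =>
    (hint.const_mul C).lintegral_lt_top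
  refine ⟨⟨?_, ?_⟩, radialGradient N Φ k, isWeakGradientOn_of_hasGradientAt hΩo
    (fun x hx => h.hasGradientAt_radialProfile hk (hΩ0 hx))
    ((h.continuousOn_radialGradient hk).mono hΩ0), ⟨?_, ?_⟩, ?_⟩
  · exact ((h.contDiffOn_radialProfile hk).continuousOn.mono hΩ0).aestronglyMeasurable hΩm
  · obtain ⟨C, -, hC⟩ := h.exists_sobolevConj_radialProfile_le hk hr
    refine (setLIntegral_mono' hΩm fun x hx => ENNReal.ofReal_le_ofReal ?_).trans_lt (hfin C)
    rw [Real.norm_of_nonneg (h.radialProfile_pos hk (hΩpos x hx)).le]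
    exact hC _ (hΩr x hx).le
  · exact ((h.continuousOn_radialGradient hk).mono hΩ0).aestronglyMeasurable hΩm
  · refine (setLIntegral_mono' hΩm fun x hx => ENNReal.ofReal_le_ofReal ?_).trans_lt (hfin 1)
    rw [h.norm_radialGradient hk (hΩ0 hx), one_mul]
  choose f hf hfs hf2 hfn using
    exists_contDiff_support_subset_approx hr (h.continuousOn_radialSlope hk)
      fun s hs => h.radialSlope_pos hk hs
  have hξ := fun n =>
    isTestFunction_integral_Ioi_norm (N := N) (hf n) (half_pos hr) (hfs n)
  refine ⟨_, fun n => (hξ n).1, tendsto_luxemburgNorm_zero fun τ hτ => ?_⟩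
  have hnorm : ∀ n, ∀ x ∈ Ω,
      ‖∇ (fun x : EuclideanSpace ℝ (Fin N) => ∫ σ in Ioi ‖x‖, f n σ) x - radialGradient N Φ k x‖
        = |f n ‖x‖ - radialSlope N Φ k ‖x‖| := by
    intro n x hx
    have hx0 := hΩpos x hx
    rw [(hξ n).2 x (hΩ0 hx), radialGradient, ← sub_smul, ← sub_div, norm_smul, norm_div, norm_norm,
      div_mul_cancel₀ _ hx0.ne', Real.norm_eq_abs, ← abs_neg]
    congr 1
    ring
  have hlint : ∀ n, ∫⁻ x in Ω, ENNReal.ofReal (Φ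
      (‖∇ (fun x : EuclideanSpace ℝ (Fin N) => ∫ σ in Ioi ‖x‖, f n σ) x
        - radialGradient N Φ k x‖ / τ)) =
      ∫⁻ x in Ω, ENNReal.ofReal (Φ (|f n ‖x‖ - radialSlope N Φ k ‖x‖| / τ)) := fun n =>
    setLIntegral_congr_fun hΩm fun x hx => by simp only [hnorm n x hx]
  simp_rw [hlint]
  set l := max 1 (2 / τ) with hl
  have hl1 : 1 ≤ l := le_max_left _ _
  have hlim := tendsto_lintegral_of_dominated_convergence' (μ := volume.restrict Ω)
    (F := fun n x => ENNReal.ofReal (Φ (|f n ‖x‖ - radialSlope N Φ k ‖x‖| / τ)))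
    (f := fun _ => 0)
    (fun x => ENNReal.ofReal (l ^ q * Φ (radialSlope N Φ k ‖x‖))) ?_ ?_ (hfin _).ne ?_
  · simpa using hlim
  · intro n
    refine ENNReal.measurable_ofReal.comp_aemeasurable (ContinuousOn.aemeasurable ?_ hΩm)
    refine h.continuousOn.comp (t := Ici 0) ?_ fun x _ => div_nonneg (abs_nonneg _) hτ.le
    exact (((hf n).continuous.comp continuous_norm).continuousOn.sub
      ((h.continuousOn_radialSlope hk).comp continuous_norm.continuousOn hΩpos)).abs.div_const _
  · intro n
    filter_upwards [ae_restrict_mem hΩm] with x hx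
    have hg := h.radialSlope_pos hk (hΩpos x hx)
    refine ENNReal.ofReal_le_ofReal (le_trans ?_ (h.young_mul_le hl1 hg.le))
    refine h.monotoneOn (mem_Ici.2 (by positivity)) (mem_Ici.2 (by positivity)) ?_
    calc |f n ‖x‖ - radialSlope N Φ k ‖x‖| / τ ≤ 2 * radialSlope N Φ k ‖x‖ / τ :=
          div_le_div_of_nonneg_right (hf2 n _ (hΩr x hx).le) hτ.le
      _ = 2 / τ * radialSlope N Φ k ‖x‖ := by ring
      _ ≤ l * radialSlope N Φ k ‖x‖ := mul_le_mul_of_nonneg_right (le_max_right _ _) hg.le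
  · filter_upwards [ae_restrict_mem hΩm] with x hx
    have h1 : Tendsto (fun n : ℕ => radialSlope N Φ k ‖x‖ / ((n : ℝ) + 1)) atTop (𝓝 0) :=
      tendsto_const_nhds.div_atTop (tendsto_atTop_add_const_right _ _ tendsto_natCast_atTop_atTop)
    have h2 : Tendsto (fun n => |f n ‖x‖ - radialSlope N Φ k ‖x‖|) atTop (𝓝 0) := by
      refine squeeze_zero' (Eventually.of_forall fun n => abs_nonneg _) ?_ h1
      filter_upwards [tendsto_natCast_atTop_atTop.eventually_ge_atTop (‖x‖ - r)] with n hn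
      exact hfn n _ (hΩr x hx).le (by linarith)
    have h3 : Tendsto (fun n => |f n ‖x‖ - radialSlope N Φ k ‖x‖| / τ) atTop (𝓝[Ici 0] 0) := by
      refine tendsto_nhdsWithin_iff.2 ⟨by simpa using h2.div_const τ,
        Eventually.of_forall fun n => div_nonneg (abs_nonneg _) hτ.le⟩
    have h4 := (h.continuousOn 0 self_mem_Ici).tendsto.comp h3
    rw [h.zero] at h4
    simpa using ENNReal.tendsto_ofReal h4

end EllipticBounds

/-! ### Existence and uniqueness of the radial solution -/

theorem lemma3p1 (N : ℕ) (Φ : ℝ → ℝ) (hΦ : IsElliptic N Φ) (c r : ℝ) (hc : 0 < c) (hr : 0 < r) :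
    ∃ k : ℝ, 0 < k ∧
      (∀ k' : ℝ, 0 < k' →
        ((∫ s in Ioi r, derivInv Φ (k' * s ^ (1 - (N : ℝ)))) = c ↔ k' = k)) ∧
      ∃ w : EuclideanSpace ℝ (Fin N) → ℝ,
        (∀ x, x ≠ 0 →
          IntegrableOn (fun s : ℝ => derivInv Φ (k * s ^ (1 - (N : ℝ)))) (Ioi ‖x‖) volume ∧
          w x = ∫ s in Ioi ‖x‖, derivInv Φ (k * s ^ (1 - (N : ℝ)))) ∧
        ContDiffOn ℝ 1 w {0}ᶜ ∧
        MemBeppoLevi Φ (Metric.closedBall 0 r)ᶜ w ∧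
        IsPhiHarmonicOn Φ {0}ᶜ w ∧
        (∀ x ∈ Metric.sphere (0 : EuclideanSpace ℝ (Fin N)) r, w x = c) ∧
        Tendsto w (cocompact (EuclideanSpace ℝ (Fin N))) (𝓝 0) := by
  obtain ⟨a, b, q, h⟩ := hΦ.exists_bounds
  have hgrowth := h.radialProfile_growth hr
  obtain ⟨k, hk, hkc⟩ := hgrowth.exists_eq hc
  refine ⟨k, hk, fun k' hk' => ⟨fun e => ?_, fun e => e ▸ hkc⟩,
    fun x => radialProfile N Φ k ‖x‖,
    fun x hx => ⟨h.integrableOn_radialSlope hk (norm_pos_iff.2 hx), rfl⟩,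
    h.contDiffOn_radialProfile hk, h.memBeppoLevi_radialProfile hk hr,
    h.isPhiHarmonicOn_radialProfile hk, fun x hx => ?_, ?_⟩
  · exact hgrowth.strictMonoOn.injOn hk' hk (e.trans hkc.symm)
  · simpa only [mem_sphere_zero_iff_norm.1 hx] using hkc
  · exact (tendsto_integral_Ioi_zero (f := radialSlope N Φ k) tendsto_id).comp
      tendsto_norm_cocompact_atTop
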